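/- An instance of the Steiner Tree problem consists of a connected graph $G=(V,E)$ and a set $S\subseteq V$ of terminals; a Steiner tree is a subtree of $G$ that contains all of $S$, and its size is its number of edges. For a function $\psi$ with $\psi(n)>0$ for all $n$, an instance with $n=|V|$ is called $\psi(n)$-dense if every terminal has at least $|V\setminus S|/\psi(n)$ neighbours in $V\setminus S$. Theorem. $\psi(n)$-dense instances of the Steiner Tree problem can be approximated within $1+\delta$ in time $n^{O(1)}2^{O(\psi(n)/\delta)}$. Precisely: there are an absolute constant $C$ and a single deterministic algorithm (a program for a random access machine whose elementary operations, each of cost one, are addition, truncated subtraction, halving, zero test and array access) such that the following holds for every $\psi:\mathbb N\to(0,\infty)$ and every real $\delta>0$. Given a $\psi(n)$-dense instance $(G,S)$ with $n=|V|$ and any rational number $r$ with $\delta/2\le r\le\delta$ (for instance $r=\delta$ if $\delta$ is rational), the algorithm halts after at most $C\,n^{C}\,2^{C\psi(n)/\delta}$ steps and outputs a Steiner tree for $S$ in $G$ whose size is at most $(1+\delta)$ times the size of every Steiner tree for $S$ in $G$. -/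

import Mathlib

/-! ### A random access machine with a step count

Structured programs over natural-number variables and arrays. Elementary operations are addition,
truncated subtraction, halving and (indirect) array access; each costs one step. There is no
unit-cost multiplication, so that the model is polynomially equivalent to Turing machines. -/

namespace RAM

/-- A machine state: the contents of the variables and of the arrays (array `a`, cell `i`). -/
structure State where
  var : ℕ → ℕ
  arr : ℕ → ℕ → ℕ

/-- Assign the value `k` to the variable `x`. -/
def State.setVar (σ : State) (x k : ℕ) : State where
  var := Function.update σ.var x k
  arr := σ.arr

/-- Write the value `k` into cell `i` of the array `a`. -/
def State.setArr (σ : State) (a i k : ℕ) : State where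
  var := σ.var
  arr := Function.update σ.arr a (Function.update (σ.arr a) i k)

/-- Arithmetic expressions. -/
inductive Exp where
  | const (k : ℕ)
  | var (x : ℕ)
  | read (a : ℕ) (i : Exp)
  | add (e f : Exp)
  | sub (e f : Exp)
  | half (e : Exp)

/-- The value of an expression in a state. -/
def Exp.val (σ : State) : Exp → ℕ
  | .const k => k
  | .var x => σ.var x
  | .read a i => σ.arr a (i.val σ)
  | .add e f => e.val σ + f.val σ
  | .sub e f => e.val σ - f.val σ
  | .half e => e.val σ / 2

/-- The number of elementary steps needed to evaluate an expression. -/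
def Exp.cost : Exp → ℕ
  | .const _ => 1
  | .var _ => 1
  | .read _ i => i.cost + 1
  | .add e f => e.cost + f.cost + 1
  | .sub e f => e.cost + f.cost + 1
  | .half e => e.cost + 1

/-- Programs. A condition `e` counts as true when its value is not zero. -/
inductive Prog where
  | skip
  | assign (x : ℕ) (e : Exp)
  | write (a : ℕ) (i e : Exp)
  | seq (P Q : Prog)
  | cond (e : Exp) (P Q : Prog)
  | loop (e : Exp) (P : Prog)

/-- `Exec P σ τ t`: started in the state `σ`, the program `P` halts in the state `τ` after exactly
`t` steps. -/
inductive Exec : Prog → State → State → ℕ → Prop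
  | skip (σ : State) : Exec .skip σ σ 1
  | assign (σ : State) (x : ℕ) (e : Exp) :
      Exec (.assign x e) σ (σ.setVar x (e.val σ)) (e.cost + 1)
  | write (σ : State) (a : ℕ) (i e : Exp) :
      Exec (.write a i e) σ (σ.setArr a (i.val σ) (e.val σ)) (i.cost + e.cost + 1)
  | seq {P Q : Prog} {σ τ ρ : State} {s t : ℕ} :
      Exec P σ τ s → Exec Q τ ρ t → Exec (.seq P Q) σ ρ (s + t)
  | condTrue {e : Exp} {P Q : Prog} {σ τ : State} {t : ℕ} :
      e.val σ ≠ 0 → Exec P σ τ t → Exec (.cond e P Q) σ τ (e.cost + 1 + t)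
  | condFalse {e : Exp} {P Q : Prog} {σ τ : State} {t : ℕ} :
      e.val σ = 0 → Exec Q σ τ t → Exec (.cond e P Q) σ τ (e.cost + 1 + t)
  | loopStop {e : Exp} {P : Prog} {σ : State} :
      e.val σ = 0 → Exec (.loop e P) σ σ (e.cost + 1)
  | loopStep {e : Exp} {P : Prog} {σ τ ρ : State} {s t : ℕ} :
      e.val σ ≠ 0 → Exec P σ τ s → Exec (.loop e P) τ ρ t →
      Exec (.loop e P) σ ρ (e.cost + 1 + s + t)

end RAM

/-! ### The Steiner Tree problem -/

/-- Every terminal has at least `|V ∖ S| / d` neighbours outside of the terminal set `S`. -/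
def IsDenseSteinerInstance {V : Type*} (G : SimpleGraph V) (S : Set V) (d : ℝ) : Prop :=
  ∀ t ∈ S, (Sᶜ.ncard : ℝ) / d ≤ ((G.neighborSet t \ S).ncard : ℝ)

/-- A tree within `G` that contains all terminals. -/
def IsSteinerTree {V : Type*} {G : SimpleGraph V} (S : Set V) (T : G.Subgraph) : Prop :=
  T.coe.IsTree ∧ S ⊆ T.verts

/-- The size of a tree is its number of edges. -/
noncomputable def treeSize {V : Type*} {G : SimpleGraph V} (T : G.Subgraph) : ℕ :=
  T.edgeSet.ncard

open Classical in
/-- The initial state for the input consisting of a graph `G` on `n` vertices, a terminal set `S`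
and a rational number `r ≥ 0`: variable 0 holds `n`, variables 1 and 2 hold the numerator and the
denominator of `r`, array 0 holds the adjacency matrix (row by row), array 1 the indicator vector
of `S`, and everything else is zero. -/
noncomputable def steinerInput {n : ℕ} (G : SimpleGraph (Fin n)) (S : Set (Fin n)) (r : ℚ) :
    RAM.State where
  var x := if x = 0 then n else if x = 1 then r.num.toNat else if x = 2 then r.den else 0
  arr a k :=
    if a = 0 then (if ∃ i j : Fin n, k = i * n + j ∧ G.Adj i j then 1 else 0)
    else if a = 1 then (if ∃ i : Fin n, k = i ∧ i ∈ S then 1 else 0)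
    else 0

open Classical in
/-- In the state `σ`, array 2 holds the adjacency matrix of the subgraph `T` (row by row) and
array 3 holds the indicator vector of its vertex set. -/
def HoldsSubgraph {n : ℕ} {G : SimpleGraph (Fin n)} (σ : RAM.State) (T : G.Subgraph) : Prop :=
  (∀ i j : Fin n, σ.arr 2 (i * n + j) = if T.Adj i j then 1 else 0) ∧
  (∀ i : Fin n, σ.arr 3 i = if i ∈ T.verts then 1 else 0)

/-! The algorithm keeps a vertex set `W` that contains the terminals `S` and enlarges it until it is
connected in `G`; any spanning tree of `W` is then a Steiner tree with `|W| - 1` edges, so that all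
that matters is how many vertices are added. Write `n` for the number of vertices, `r` for the
precision and `D = ψ n` for the density parameter. The set `W` starts as `S`, or as a single vertex
if there are no terminals.

*Greedy phase* (`grow`). Let `t = ⌈1 / r⌉`, capped at `n`. While some vertex outside of `W` is
adjacent to more than `t` components of `G[W]`, it is added. Each addition lowers the number of
components by at least `t`, so at most `(|S| - 1) / t ≤ r (|S| - 1)` vertices are added. Let `U` be
the set at the end of this phase; each of its components contains a terminal. Choose one terminal
in each of the `k` components and count the edges between these and `V ∖ S`: density gives at
least `k |V ∖ S| / D` of them, and no vertex sees more than `t` components. Hence `k ≤ D t`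
(`numComp_le_of_dense`); if `V = S`, then `k = 1` because `G` is connected.

*Exact phase* (`merge`). Let `q = ⌊1 + r⌋` (again capped) and let `g` be `(k - 1) / q` rounded up.
In each of at most `q` rounds, representatives of up to `g + 1` components of the current `W` are
joined by a connected set with as few vertices outside of `W` as possible. It is found by dynamic
programming over the subsets of the representatives, as in the algorithm of Dreyfus and Wagner. For
a connected set `B ⊇ S`, the set `B ∪ W` is a candidate, so each round adds at most `|B ∖ S|`
vertices, while it lowers the number of components by `g` or down to one. As `q ≤ 1 + r`, the two
phases together yield `|W| - 1 ≤ (1 + r) (|B| - 1)` (`ratio_bound`). Since `g ≤ 1 + 2 D / r`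
(`group_bound`), the tables have at most `2 ^ (2 + 2 D / r)` entries per vertex.

*Running time.* The weakest precondition `Prog.wp y` demands that every execution of a loop makes at
most `y` iterations. For a fixed program the number of steps is then bounded by a polynomial in `y`
(`Prog.exists_time_le`), and `y = n ⌈4 · 2 ^ (4 D / δ)⌉` is large
enough because `D / r ≤ 2 D / δ`. -/

namespace RAM

/-! ### A program logic with a step bound -/

/-- A bound on the number of steps of a program in which every execution of a loop makes at most
`y` rounds. -/
def Prog.time (y : ℕ) : Prog → ℕ
  | .skip => 1
  | .assign _ e => e.cost + 1
  | .write _ i e => i.cost + e.cost + 1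
  | .seq P Q => P.time y + Q.time y
  | .cond e P Q => e.cost + 1 + (P.time y + Q.time y)
  | .loop e P => (y + 1) * (e.cost + 1) + y * P.time y

/-- For a fixed program the step bound is polynomial in the bound on the number of rounds. -/
theorem Prog.exists_time_le (P : Prog) : ∃ C : ℕ, ∀ y : ℕ, 1 ≤ y → P.time y ≤ C * y ^ C := by
  have mono : ∀ {a b y : ℕ}, 1 ≤ y → a ≤ b → a * y ^ a ≤ b * y ^ b := fun hy hab =>
    Nat.mul_le_mul hab (Nat.pow_le_pow_right hy hab)
  have base : ∀ c : ℕ, ∀ y : ℕ, 1 ≤ y → c ≤ c * y ^ c := fun c y hy =>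
    Nat.le_mul_of_pos_right _ (Nat.pow_pos hy)
  have sum : ∀ {a b y : ℕ}, 1 ≤ y → a * y ^ a + b * y ^ b ≤ (a + b) * y ^ (a + b) := by
    intro a b y hy
    rw [add_mul]
    exact Nat.add_le_add (Nat.mul_le_mul le_rfl (Nat.pow_le_pow_right hy (by omega)))
      (Nat.mul_le_mul le_rfl (Nat.pow_le_pow_right hy (by omega)))
  induction P with
  | skip => exact ⟨1, fun y hy => base 1 y hy⟩
  | assign x e => exact ⟨e.cost + 1, fun y hy => base _ y hy⟩
  | write a i e => exact ⟨i.cost + e.cost + 1, fun y hy => base _ y hy⟩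
  | seq P Q hP hQ =>
    obtain ⟨a, ha⟩ := hP
    obtain ⟨b, hb⟩ := hQ
    exact ⟨a + b, fun y hy => (Nat.add_le_add (ha y hy) (hb y hy)).trans (sum hy)⟩
  | cond e P Q hP hQ =>
    obtain ⟨a, ha⟩ := hP
    obtain ⟨b, hb⟩ := hQ
    exact ⟨e.cost + 1 + (a + b), fun y hy => (Nat.add_le_add (base _ y hy)
      ((Nat.add_le_add (ha y hy) (hb y hy)).trans (sum hy))).trans (sum hy)⟩
  | loop e P hP =>
    obtain ⟨a, ha⟩ := hP
    refine ⟨2 * (e.cost + 1) + (a + 1), fun y hy => ?_⟩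
    refine le_trans (Nat.add_le_add ?_ ?_) (sum hy)
    · have h1 : y + 1 ≤ 2 * y := by omega
      have h2 : y ≤ y ^ (2 * (e.cost + 1)) := Nat.le_self_pow (by omega) y
      calc (y + 1) * (e.cost + 1) ≤ 2 * y * (e.cost + 1) := Nat.mul_le_mul h1 le_rfl
        _ = 2 * (e.cost + 1) * y := by ring
        _ ≤ _ := Nat.mul_le_mul le_rfl h2
    · calc y * P.time y ≤ y * (a * y ^ a) := Nat.mul_le_mul le_rfl (ha y hy)
        _ = a * y ^ (a + 1) := by ring
        _ ≤ _ := Nat.mul_le_mul (by omega) le_rfl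

/-- The weakest precondition of at most `k` rounds of a loop, in terms of that of its body. -/
def wpIter (e : Exp) (body : (State → Prop) → State → Prop) (Q : State → Prop) :
    ℕ → State → Prop
  | 0, σ => e.val σ = 0 ∧ Q σ
  | k + 1, σ => (e.val σ = 0 → Q σ) ∧ (e.val σ ≠ 0 → body (wpIter e body Q k) σ)

/-- The weakest precondition for `P` to halt in a state with `Q`, where no execution of a loop
makes more than `y` rounds. -/
def Prog.wp (y : ℕ) : Prog → (State → Prop) → State → Prop
  | .skip, Q, σ => Q σ
  | .assign x e, Q, σ => Q (σ.setVar x (e.val σ))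
  | .write a i e, Q, σ => Q (σ.setArr a (i.val σ) (e.val σ))
  | .seq P P', Q, σ => P.wp y (P'.wp y Q) σ
  | .cond e P P', Q, σ => (e.val σ ≠ 0 → P.wp y Q σ) ∧ (e.val σ = 0 → P'.wp y Q σ)
  | .loop e P, Q, σ => wpIter e (P.wp y) Q y σ

theorem Prog.exec_of_wp {y : ℕ} {P : Prog} {Q : State → Prop} {σ : State} (h : P.wp y Q σ) :
    ∃ τ t, Exec P σ τ t ∧ t ≤ P.time y ∧ Q τ := by
  induction P generalizing Q σ with
  | skip => exact ⟨σ, 1, .skip σ, le_rfl, h⟩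
  | assign x e => exact ⟨_, _, .assign σ x e, le_rfl, h⟩
  | write a i e => exact ⟨_, _, .write σ a i e, le_rfl, h⟩
  | seq P P' hP hP' =>
    obtain ⟨τ, s, h1, h2, h3⟩ := hP h
    obtain ⟨ρ, t, h4, h5, h6⟩ := hP' h3
    exact ⟨ρ, s + t, .seq h1 h4, Nat.add_le_add h2 h5, h6⟩
  | cond e P P' hP hP' =>
    by_cases he : e.val σ = 0
    · obtain ⟨τ, t, h1, h2, h3⟩ := hP' (h.2 he)
      exact ⟨τ, _, .condFalse he h1, by simp only [Prog.time]; omega, h3⟩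
    · obtain ⟨τ, t, h1, h2, h3⟩ := hP (h.1 he)
      exact ⟨τ, _, .condTrue he h1, by simp only [Prog.time]; omega, h3⟩
  | loop e P hP =>
    have key : ∀ (k : ℕ) (σ : State), wpIter e (P.wp y) Q k σ → ∃ τ t,
        Exec (.loop e P) σ τ t ∧ t ≤ (k + 1) * (e.cost + 1) + k * P.time y ∧ Q τ := by
      intro k
      induction k with
      | zero => exact fun σ h => ⟨σ, _, .loopStop h.1, by omega, h.2⟩
      | succ k ih =>
        intro σ h
        by_cases he : e.val σ = 0
        · exact ⟨σ, _, .loopStop he, by nlinarith [Nat.zero_le ((k + 1) * P.time y)], h.1 he⟩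
        · obtain ⟨τ, s, h1, h2, h3⟩ := hP (h.2 he)
          obtain ⟨ρ, t, h4, h5, h6⟩ := ih τ h3
          exact ⟨ρ, _, .loopStep he h1 h4, by nlinarith, h6⟩
    exact key y σ h

theorem wpIter_mono {e : Exp} {body : (State → Prop) → State → Prop}
    (hb : ∀ (Q Q' : State → Prop) (σ : State), (∀ τ, Q τ → Q' τ) → body Q σ → body Q' σ)
    {Q Q' : State → Prop} (hQ : ∀ τ, Q τ → Q' τ) (k : ℕ) :
    ∀ σ, wpIter e body Q k σ → wpIter e body Q' k σ := by
  induction k with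
  | zero => exact fun σ h => ⟨h.1, hQ _ h.2⟩
  | succ k ih => exact fun σ h => ⟨fun he => hQ _ (h.1 he), fun he => hb _ _ _ ih (h.2 he)⟩

theorem Prog.wp_mono {y : ℕ} {P : Prog} {Q Q' : State → Prop} {σ : State}
    (h : P.wp y Q σ) (hQ : ∀ τ, Q τ → Q' τ) : P.wp y Q' σ := by
  induction P generalizing Q Q' σ with
  | skip => exact hQ _ h
  | assign x e => exact hQ _ h
  | write a i e => exact hQ _ h
  | seq P P' hP hP' => exact hP h fun τ hτ => hP' hτ hQ
  | cond e P P' hP hP' => exact ⟨fun he => hP (h.1 he) hQ, fun he => hP' (h.2 he) hQ⟩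
  | loop e P hP => exact wpIter_mono (body := P.wp y) (fun _ _ _ h1 h2 => hP h2 h1) hQ y σ h

/-- Whether the program contains an assignment to the variable `x`. -/
def Prog.modVar (x : ℕ) : Prog → Bool
  | .skip => false
  | .assign z _ => x == z
  | .write _ _ _ => false
  | .seq P Q => P.modVar x || Q.modVar x
  | .cond _ P Q => P.modVar x || Q.modVar x
  | .loop _ P => P.modVar x

/-- Whether the program contains a write access to the array `a`. -/
def Prog.modArr (a : ℕ) : Prog → Bool
  | .skip => false
  | .assign _ _ => false
  | .write b _ _ => a == b
  | .seq P Q => P.modArr a || Q.modArr a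
  | .cond _ P Q => P.modArr a || Q.modArr a
  | .loop _ P => P.modArr a

/-- The states `σ` and `τ` agree wherever the program `P` cannot change anything. -/
structure Frame (P : Prog) (σ τ : State) : Prop where
  var : ∀ x, P.modVar x = false → τ.var x = σ.var x
  arr : ∀ a, P.modArr a = false → τ.arr a = σ.arr a

theorem Frame.refl (P : Prog) (σ : State) : Frame P σ σ := ⟨fun _ _ => rfl, fun _ _ => rfl⟩

theorem Frame.trans {P : Prog} {σ τ ρ : State} (h : Frame P σ τ) (h' : Frame P τ ρ) :
    Frame P σ ρ :=
  ⟨fun x hx => (h'.var x hx).trans (h.var x hx), fun a ha => (h'.arr a ha).trans (h.arr a ha)⟩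

theorem Frame.weaken {P P' : Prog} {σ τ : State} (h : Frame P σ τ)
    (hv : ∀ x, P'.modVar x = false → P.modVar x = false)
    (ha : ∀ a, P'.modArr a = false → P.modArr a = false) : Frame P' σ τ :=
  ⟨fun x hx => h.var x (hv x hx), fun a hx => h.arr a (ha a hx)⟩

theorem Prog.wp_frame {y : ℕ} {P : Prog} {Q : State → Prop} {σ : State} (h : P.wp y Q σ) :
    P.wp y (fun τ => Q τ ∧ Frame P σ τ) σ := by
  induction P generalizing Q σ with
  | skip => exact ⟨h, .refl _ _⟩
  | assign x e =>
    refine ⟨h, fun z hz => ?_, fun a _ => rfl⟩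
    simp only [Prog.modVar, beq_eq_false_iff_ne] at hz
    simp [State.setVar, hz]
  | write a i e =>
    refine ⟨h, fun z _ => rfl, fun b hb => ?_⟩
    simp only [Prog.modArr, beq_eq_false_iff_ne] at hb
    simp [State.setArr, hb]
  | seq P P' hP hP' =>
    change P.wp y (P'.wp y _) σ
    refine wp_mono (hP h) fun τ hτ => wp_mono (hP' hτ.1) fun ρ hρ => ⟨hρ.1, ?_⟩
    exact .trans (hτ.2.weaken (by simp +contextual [modVar]) (by simp +contextual [modArr]))
      (hρ.2.weaken (by simp +contextual [modVar]) (by simp +contextual [modArr]))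
  | cond e P P' hP hP' =>
    exact ⟨fun he => wp_mono (hP (h.1 he)) fun τ hτ => ⟨hτ.1,
        hτ.2.weaken (by simp +contextual [modVar]) (by simp +contextual [modArr])⟩,
      fun he => wp_mono (hP' (h.2 he)) fun τ hτ => ⟨hτ.1,
        hτ.2.weaken (by simp +contextual [modVar]) (by simp +contextual [modArr])⟩⟩
  | loop e P hP =>
    have key : ∀ (k : ℕ) (σ : State), wpIter e (P.wp y) Q k σ →
        wpIter e (P.wp y) (fun τ => Q τ ∧ Frame (.loop e P) σ τ) k σ := by
      intro k
      induction k with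
      | zero => exact fun σ h => ⟨h.1, h.2, .refl _ _⟩
      | succ k ih =>
        refine fun σ h => ⟨fun he => ⟨h.1 he, .refl _ _⟩, fun he => ?_⟩
        refine wp_mono (hP (h.2 he)) fun τ hτ => ?_
        exact wpIter_mono (body := P.wp y) (fun _ _ _ h1 h2 => wp_mono h2 h1)
          (fun ρ hρ => ⟨hρ.1, .trans (P := .loop e P)
            (hτ.2.weaken (fun _ h => h) (fun _ h => h)) hρ.2⟩) k τ (ih τ hτ.1)
    exact key y σ h

/-- The loop rule: `I k` is an invariant under which at most `k` rounds are left. -/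
theorem Prog.wp_loop {y : ℕ} {e : Exp} {P : Prog} {Q : State → Prop} {σ : State}
    (I : ℕ → State → Prop) {k : ℕ} (hk : k ≤ y) (h0 : I k σ)
    (step : ∀ k ρ, Frame P σ ρ → I k ρ → e.val ρ ≠ 0 →
      ∃ k', k' < k ∧ P.wp y (I k') ρ)
    (hQ : ∀ k ρ, Frame P σ ρ → I k ρ → e.val ρ = 0 → Q ρ) :
    (Prog.loop e P).wp y Q σ := by
  have key : ∀ (b : ℕ) (ρ : State) (k : ℕ), k ≤ b → Frame P σ ρ → I k ρ →
      wpIter e (P.wp y) Q b ρ := by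
    intro b
    induction b with
    | zero =>
      intro ρ k hk hF hI
      have he : e.val ρ = 0 := by
        by_contra he
        obtain ⟨k', h1, _⟩ := step k ρ hF hI he
        omega
      exact ⟨he, hQ k ρ hF hI he⟩
    | succ b ih =>
      refine fun ρ k hk hF hI => ⟨hQ k ρ hF hI, fun he => ?_⟩
      obtain ⟨k', h1, h2⟩ := step k ρ hF hI he
      exact wp_mono (wp_frame h2) fun τ hτ => ih τ k' (by omega) (hF.trans hτ.2) hτ.1
  exact key y σ k hk (.refl _ _) h0

/-- `forTo i b P` runs `P` for `i = 0, 1, …, b - 1`, where `i` and `b` are variables. -/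
def forTo (i b : ℕ) (P : Prog) : Prog :=
  .seq (.assign i (.const 0))
    (.loop (.sub (.var b) (.var i)) (.seq P (.assign i (.add (.var i) (.const 1)))))

theorem Frame.setVar {P : Prog} {σ τ : State} {i k : ℕ} (h : Frame P σ τ)
    (hi : P.modVar i = true) : Frame P σ (τ.setVar i k) := by
  refine ⟨fun x hx => ?_, h.arr⟩
  have : x ≠ i := by rintro rfl; simp [hi] at hx
  simpa [State.setVar, this] using h.var x hx

theorem wp_forTo {y i b m : ℕ} {P : Prog} {Q : State → Prop} {σ : State}
    (I : ℕ → State → Prop) (hm : σ.var b = m) (hmy : m ≤ y) (hib : i ≠ b)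
    (hi : P.modVar i = false) (hb : P.modVar b = false)
    (hI : ∀ j ρ k, I j ρ → I j (ρ.setVar i k)) (h0 : I 0 σ)
    (step : ∀ j ρ, j < m → Frame (forTo i b P) σ ρ → ρ.var i = j → I j ρ →
      P.wp y (I (j + 1)) ρ)
    (hQ : ∀ ρ, Frame (forTo i b P) σ ρ → I m ρ → Q ρ) :
    (forTo i b P).wp y Q σ := by
  have hmod : (forTo i b P).modVar i = true := by simp [forTo, Prog.modVar]
  have hmodb : (forTo i b P).modVar b = false := by simp [forTo, Prog.modVar, hb, hib.symm]
  have hweak : ∀ {ρ τ}, Frame (Prog.seq P (.assign i (.add (.var i) (.const 1)))) ρ τ →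
      Frame (forTo i b P) ρ τ := fun h =>
    h.weaken (by simp +contextual [Prog.modVar, forTo]) (by simp +contextual [Prog.modArr, forTo])
  change Prog.wp y (.loop _ _) Q (σ.setVar i 0)
  have hF0 : Frame (forTo i b P) σ (σ.setVar i 0) := (Frame.refl _ _).setVar hmod
  refine Prog.wp_loop (fun k ρ => ρ.var i + k = m ∧ I (ρ.var i) ρ) hmy ?_ ?_ ?_
  · simp only [State.setVar, Function.update_self]
    exact ⟨by omega, hI _ _ _ h0⟩
  · intro k ρ hF ⟨h1, h2⟩ he
    have hF' := hF0.trans (hweak hF)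
    have hbm : ρ.var b = m := (hF'.var b hmodb).trans hm
    simp only [Exp.val, hbm] at he
    refine ⟨k - 1, by omega, ?_⟩
    change P.wp y (Prog.wp y _ _) ρ
    refine Prog.wp_mono (Prog.wp_frame (step _ ρ (by omega) hF' rfl h2)) fun τ hτ => ?_
    have hτi := hτ.2.var i hi
    simp only [Prog.wp, Exp.val, hτi, State.setVar, Function.update_self]
    exact ⟨by omega, hI _ _ _ hτ.1⟩
  · intro k ρ hF ⟨h1, h2⟩ he
    have hF' := hF0.trans (hweak hF)
    have hbm : ρ.var b = m := (hF'.var b hmodb).trans hm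
    simp only [Exp.val, hbm] at he
    have : ρ.var i = m := by omega
    exact hQ ρ hF' (this ▸ h2)

/-- A `for` loop whose body establishes `A j` in round `j`, where later rounds only move along a
preorder `R` that keeps all `A j`. -/
theorem wp_forTo_forall {y i b m : ℕ} {P : Prog} {Q : State → Prop} {σ : State}
    (J : State → Prop) (R : State → State → Prop) (A : ℕ → State → Prop)
    (hm : σ.var b = m) (hmy : m ≤ y) (hib : i ≠ b)
    (hi : P.modVar i = false) (hb : P.modVar b = false)
    (hR : ∀ ρ, R ρ ρ) (hR' : ∀ ρ τ υ, R ρ τ → R τ υ → R ρ υ)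
    (hA : ∀ j ρ τ, R ρ τ → A j ρ → A j τ)
    (hJi : ∀ ρ k, J ρ → J (ρ.setVar i k)) (hRi : ∀ ρ k, R ρ (ρ.setVar i k))
    (h0 : J σ)
    (step : ∀ j ρ, j < m → Frame (forTo i b P) σ ρ → ρ.var i = j → J ρ → R σ ρ →
      P.wp y (fun τ => J τ ∧ R ρ τ ∧ A j τ) ρ)
    (hQ : ∀ ρ, Frame (forTo i b P) σ ρ → J ρ → R σ ρ → (∀ j < m, A j ρ) → Q ρ) :
    (forTo i b P).wp y Q σ := by
  refine wp_forTo (fun j ρ => J ρ ∧ R σ ρ ∧ ∀ j' < j, A j' ρ) hm hmy hib hi hb ?_ ?_ ?_ ?_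
  · exact fun j ρ k h => ⟨hJi _ _ h.1, hR' _ _ _ h.2.1 (hRi _ _),
      fun j' hj' => hA _ _ _ (hRi _ _) (h.2.2 j' hj')⟩
  · exact ⟨h0, hR _, fun _ h => absurd h (Nat.not_lt_zero _)⟩
  · rintro j ρ hj hF hv ⟨h1, h2, h3⟩
    refine Prog.wp_mono (step j ρ hj hF hv h1 h2) ?_
    rintro τ ⟨g1, g2, g3⟩
    refine ⟨g1, hR' _ _ _ h2 g2, fun j' hj' => ?_⟩
    rcases Nat.lt_succ_iff_lt_or_eq.mp hj' with h | rfl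
    · exact hA _ _ _ g2 (h3 j' h)
    · exact g3
  · exact fun ρ hF h => hQ ρ hF h.1 h.2.1 h.2.2

end RAM

namespace DenseSteiner

/-! ### Connectivity within a vertex set -/

/-- The edges of `G` with both ends in `U`, as a graph on all vertices. -/
def inside {V : Type*} (G : SimpleGraph V) (U : Finset V) : SimpleGraph V where
  Adj a b := G.Adj a b ∧ a ∈ U ∧ b ∈ U
  symm := ⟨fun _ _ h => ⟨h.1.symm, h.2.2, h.2.1⟩⟩
  loopless := ⟨fun _ h => G.loopless.irrefl _ h.1⟩

theorem inside_mono {V : Type*} {G : SimpleGraph V} {U W : Finset V} (h : U ⊆ W) :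
    inside G U ≤ inside G W := fun _ _ hab => ⟨hab.1, h hab.2.1, h hab.2.2⟩

theorem reachable_mono {V : Type*} {G : SimpleGraph V} {U W : Finset V} (h : U ⊆ W) {a b : V}
    (hab : (inside G U).Reachable a b) : (inside G W).Reachable a b :=
  hab.mono (inside_mono h)

theorem reachable_of_adj {V : Type*} {G : SimpleGraph V} {U : Finset V} {a b : V}
    (h : G.Adj a b) (ha : a ∈ U) (hb : b ∈ U) : (inside G U).Reachable a b :=
  SimpleGraph.Adj.reachable (G := inside G U) ⟨h, ha, hb⟩

theorem mem_of_reachable {V : Type*} {G : SimpleGraph V} {U : Finset V} {a b : V}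
    (h : (inside G U).Reachable a b) (ha : a ∈ U) : b ∈ U := by
  rw [SimpleGraph.reachable_iff_reflTransGen] at h
  induction h with
  | refl => exact ha
  | tail _ h _ => exact h.2.2

/-- The number of components of the subgraph induced by `U`. -/
noncomputable def numComp {V : Type*} (G : SimpleGraph V) (U : Finset V) : ℕ :=
  open Classical in (U.image (inside G U).connectedComponentMk).card

/-- `L` assigns to every vertex a representative of its component in the subgraph induced
by `U`. -/
structure IsLabel {V : Type*} (G : SimpleGraph V) (U : Finset V) (L : V → V) : Prop where
  eq_iff : ∀ u v, L u = L v ↔ (inside G U).Reachable u v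
  idem : ∀ v, L (L v) = L v

section Components

variable {V : Type*} {G : SimpleGraph V} {U W : Finset V} {L : V → V}

theorem IsLabel.reachable (h : IsLabel G U L) (v : V) : (inside G U).Reachable (L v) v :=
  (h.eq_iff _ _).mp (h.idem v)

theorem IsLabel.mem (h : IsLabel G U L) {v : V} (hv : v ∈ U) : L v ∈ U :=
  mem_of_reachable (h.reachable v).symm hv

theorem numComp_le_card (D : Finset V)
    (hD : ∀ x ∈ U, ∃ d ∈ D, (inside G U).Reachable x d) : numComp G U ≤ D.card := by
  classical
  unfold numComp
  refine (Finset.card_le_card ?_).trans (Finset.card_image_le (s := D)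
    (f := (inside G U).connectedComponentMk))
  intro c hc
  obtain ⟨x, hx, rfl⟩ := Finset.mem_image.mp hc
  obtain ⟨d, hd, hxd⟩ := hD x hx
  exact Finset.mem_image.mpr ⟨d, hd, SimpleGraph.ConnectedComponent.eq.mpr hxd.symm⟩

theorem one_le_numComp (h : U.Nonempty) : 1 ≤ numComp G U := by
  classical
  unfold numComp
  exact Finset.card_pos.mpr (h.image _)

theorem reachable_of_numComp_le_one (h : numComp G U ≤ 1) {u v : V} (hu : u ∈ U) (hv : v ∈ U) :
    (inside G U).Reachable u v := by
  classical
  unfold numComp at h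
  exact SimpleGraph.ConnectedComponent.eq.mp (Finset.card_le_one.mp h _
    (Finset.mem_image_of_mem _ hu) _ (Finset.mem_image_of_mem _ hv))

variable [DecidableEq V]

theorem IsLabel.numComp_eq (h : IsLabel G U L) : numComp G U = (U.image L).card := by
  classical
  unfold numComp
  have key : (U.image L).image (inside G U).connectedComponentMk
      = U.image (inside G U).connectedComponentMk := by
    rw [Finset.image_image]
    exact Finset.image_congr fun v _ => SimpleGraph.ConnectedComponent.eq.mpr (h.reachable v)
  have key' := congrArg Finset.card key
  refine (Eq.trans (by congr!) key'.symm).trans ?_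
  · refine Finset.card_image_of_injOn fun a ha b hb hab => ?_
    obtain ⟨u, _, rfl⟩ := Finset.mem_image.mp ha
    obtain ⟨v, _, rfl⟩ := Finset.mem_image.mp hb
    have := (h.eq_iff _ _).mpr (SimpleGraph.ConnectedComponent.eq.mp hab)
    rwa [h.idem, h.idem] at this

theorem IsLabel.image_eq_filter (h : IsLabel G U L) :
    U.image L = U.filter fun v => L v = v := by
  ext v
  simp only [Finset.mem_image, Finset.mem_filter]
  exact ⟨fun ⟨u, hu, huv⟩ => huv ▸ ⟨h.mem hu, h.idem u⟩, fun hv => ⟨v, hv⟩⟩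

/-- If `W` arises from `U` by adding vertices that are all joined within `W` to a vertex `c`, and so
are the components with the labels in `A`, then the components in `A` are merged into one. -/
theorem numComp_add_card_le (hL : IsLabel G U L) (hUW : U ⊆ W) {A : Finset V}
    (hA : A ⊆ U.image L) {c : V} (hc : ∀ x ∈ W, x ∉ U → (inside G W).Reachable x c)
    (hAc : ∀ a ∈ A, (inside G W).Reachable a c) :
    numComp G W + A.card ≤ numComp G U + 1 := by
  have h1 : numComp G W ≤ (insert c (U.image L \ A)).card := by
    refine numComp_le_card _ fun x hx => ?_
    by_cases hxU : x ∈ U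
    · have hx' := reachable_mono hUW (hL.reachable x).symm
      by_cases hxA : L x ∈ A
      · exact ⟨c, Finset.mem_insert_self _ _, hx'.trans (hAc _ hxA)⟩
      · exact ⟨L x, Finset.mem_insert_of_mem
          (Finset.mem_sdiff.mpr ⟨Finset.mem_image_of_mem L hxU, hxA⟩), hx'⟩
    · exact ⟨c, Finset.mem_insert_self _ _, hc x hx hxU⟩
  have h2 := Finset.card_insert_le c (U.image L \ A)
  have h3 := Finset.card_sdiff_add_card_eq_card hA
  rw [← hL.numComp_eq] at h3
  omega

/-- Every component of the subgraph induced by `U` meets `S`. -/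
def Anchored (G : SimpleGraph V) (S U : Finset V) : Prop :=
  ∀ u ∈ U, ∃ s ∈ S, (inside G U).Reachable u s

theorem Anchored.extend {S : Finset V} (h : Anchored G S U) (hUW : U ⊆ W) {c u : V} (hu : u ∈ U)
    (hcu : (inside G W).Reachable c u)
    (hc : ∀ x ∈ W, x ∉ U → (inside G W).Reachable x c) : Anchored G S W := by
  intro x hx
  by_cases hxU : x ∈ U
  · obtain ⟨s, hs, hxs⟩ := h x hxU
    exact ⟨s, hs, reachable_mono hUW hxs⟩
  · obtain ⟨s, hs, hus⟩ := h u hu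
    exact ⟨s, hs, ((hc x hx hxU).trans hcu).trans (reachable_mono hUW hus)⟩

/-- The labels of the components of `U` that contain a neighbour of `w`. -/
noncomputable def seen (G : SimpleGraph V) (U : Finset V) (L : V → V) (w : V) : Finset V :=
  open Classical in (U.filter fun u => G.Adj w u).image L

theorem mem_seen {w z : V} : z ∈ seen G U L w ↔ ∃ u ∈ U, G.Adj w u ∧ L u = z := by
  classical
  unfold seen
  simp [and_assoc]

theorem seen_subset (w : V) : seen G U L w ⊆ U.image L := by
  intro z hz
  obtain ⟨u, hu, _, h⟩ := mem_seen.mp hz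
  exact Finset.mem_image.mpr ⟨u, hu, h⟩

theorem seen_reachable (hL : IsLabel G U L) {w z : V} (hz : z ∈ seen G U L w) :
    (inside G (insert w U)).Reachable z w := by
  obtain ⟨u, hu, hwu, rfl⟩ := mem_seen.mp hz
  exact (reachable_mono (Finset.subset_insert _ _) (hL.reachable u)).trans
    (reachable_of_adj hwu.symm (Finset.mem_insert_of_mem hu) (Finset.mem_insert_self _ _))

theorem numComp_insert_add_card_seen_le (hL : IsLabel G U L) (w : V) :
    numComp G (insert w U) + (seen G U L w).card ≤ numComp G U + 1 := by
  refine numComp_add_card_le hL (Finset.subset_insert w U) (seen_subset w) (c := w) ?_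
    fun a ha => seen_reachable hL ha
  intro x hx hxU
  rcases Finset.mem_insert.mp hx with rfl | h
  · exact .rfl
  · exact absurd h hxU

theorem Anchored.insert {S : Finset V} (h : Anchored G S U) (hL : IsLabel G U L) {w : V}
    (hw : (seen G U L w).Nonempty) : Anchored G S (insert w U) := by
  obtain ⟨z, hz⟩ := hw
  have hzU : z ∈ U := by
    obtain ⟨u, hu, _, rfl⟩ := mem_seen.mp hz
    exact hL.mem hu
  refine h.extend (Finset.subset_insert w U) hzU (seen_reachable hL hz).symm ?_
  intro x hx hxU
  rcases Finset.mem_insert.mp hx with rfl | h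
  · exact .rfl
  · exact absurd h hxU

/-- The density estimate: if no vertex sees more than `t` components, then a `d`-dense instance
with a non-terminal has at most `d * t` components. Both sides count the pairs of a component and a
non-terminal next to a fixed terminal of that component. -/
theorem numComp_le_of_dense [Fintype V] {S : Finset V} {d : ℝ} (hd : 0 < d)
    (hdense : IsDenseSteinerInstance G (S : Set V) d) (hS : ∃ w, w ∉ S)
    (hL : IsLabel G U L) (hSU : S ⊆ U) (hanch : Anchored G S U) {t : ℕ}
    (ht : ∀ w, (seen G U L w).card ≤ t) : (numComp G U : ℝ) ≤ d * t := by
  classical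
  set m : ℕ := Sᶜ.card with hm
  have hm0 : 0 < m := by
    obtain ⟨w, hw⟩ := hS
    exact Finset.card_pos.mpr ⟨w, Finset.mem_compl.mpr hw⟩
  have hterm : ∀ z ∈ U.image L, ∃ s ∈ S, L s = z := by
    intro z hz
    obtain ⟨u, hu, rfl⟩ := Finset.mem_image.mp hz
    obtain ⟨s, hs, hus⟩ := hanch u hu
    exact ⟨s, hs, ((hL.eq_iff _ _).mpr hus).symm⟩
  choose! f hf hfL using hterm
  have hcount : ∑ z ∈ U.image L, (Sᶜ.filter fun w => G.Adj (f z) w).card ≤ m * t := by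
    rw [hm, ← smul_eq_mul]
    refine (Finset.sum_card_bipartiteAbove_eq_sum_card_bipartiteBelow
      (fun z w => G.Adj (f z) w)).trans_le ?_
    refine Finset.sum_le_card_nsmul _ _ _ fun w _ => le_trans (Finset.card_le_card ?_) (ht w)
    intro z hz
    rw [Finset.mem_bipartiteBelow] at hz
    exact mem_seen.mpr ⟨f z, hSU (hf z hz.1), hz.2.symm, hfL z hz.1⟩
  have hdeg : ∀ z ∈ U.image L, (m : ℝ) / d ≤ ((Sᶜ.filter fun w => G.Adj (f z) w).card : ℝ) := by
    intro z hz
    have h := hdense (f z) (Finset.mem_coe.mpr (hf z hz))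
    rw [← Finset.coe_compl, Set.ncard_coe_finset] at h
    convert h using 2
    rw [← Set.ncard_coe_finset]
    congr 1
    ext w
    simp [and_comm]
  have h1 : (numComp G U : ℝ) * (m / d) ≤ m * t := by
    rw [hL.numComp_eq, ← nsmul_eq_mul]
    refine (Finset.card_nsmul_le_sum _ _ _ hdeg).trans ?_
    exact_mod_cast hcount
  have hm' : (0 : ℝ) < m := by exact_mod_cast hm0
  rw [mul_div_assoc', div_le_iff₀ hd] at h1
  nlinarith

end Components

/-! ### Connected vertex sets -/

/-- The subgraph of `G` induced by `B` is connected and contains `v`. -/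
def Rooted {V : Type*} (G : SimpleGraph V) (B : Finset V) (v : V) : Prop :=
  v ∈ B ∧ ∀ x ∈ B, (inside G B).Reachable v x

section Rooted

variable {V : Type*} {G : SimpleGraph V} {B C : Finset V}

theorem Rooted.singleton (v : V) : Rooted G {v} v :=
  ⟨Finset.mem_singleton_self v, fun x hx => by rw [Finset.mem_singleton.mp hx]⟩

theorem Rooted.change {v w : V} (h : Rooted G B v) (hw : w ∈ B) : Rooted G B w :=
  ⟨hw, fun x hx => (h.2 w hw).symm.trans (h.2 x hx)⟩

variable [DecidableEq V]

theorem Rooted.union {u v : V} (h : Rooted G B v) (h' : Rooted G C u) (huv : G.Adj v u) :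
    Rooted G (B ∪ C) v := by
  refine ⟨Finset.mem_union_left _ h.1, fun x hx => ?_⟩
  rcases Finset.mem_union.mp hx with hx | hx
  · exact reachable_mono Finset.subset_union_left (h.2 x hx)
  · exact (reachable_of_adj huv (Finset.mem_union_left _ h.1)
      (Finset.mem_union_right _ h'.1)).trans
      (reachable_mono Finset.subset_union_right (h'.2 x hx))

/-- A connected set with more than one vertex falls into two connected sets that are joined by an
edge at a given vertex `v`: one of them is a component of the rest after removing `v`. -/
theorem Rooted.split {v : V} (h : Rooted G B v) (hB : B ≠ {v}) :
    ∃ u B₁ B₂, G.Adj v u ∧ Rooted G B₁ v ∧ Rooted G B₂ u ∧ Disjoint B₁ B₂ ∧ B₁ ∪ B₂ = B := by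
  classical
  obtain ⟨x, hx, hxv⟩ : ∃ x ∈ B, x ≠ v := by
    by_contra! hcon
    exact hB (Finset.eq_singleton_iff_unique_mem.mpr ⟨h.1, hcon⟩)
  obtain ⟨u, hu⟩ : ∃ u, (inside G B).Adj v u := by
    obtain ⟨p⟩ := h.2 x hx
    cases p with
    | nil => exact absurd rfl hxv
    | cons hvu _ => exact ⟨_, hvu⟩
  have huv : u ≠ v := hu.1.ne'
  have huB : u ∈ B.erase v := Finset.mem_erase.mpr ⟨huv, hu.2.2⟩
  set B₂ := B.filter fun x => (inside G (B.erase v)).Reachable u x with hB₂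
  have hmem : ∀ {x}, (inside G (B.erase v)).Reachable u x → x ∈ B₂ := fun hx =>
    Finset.mem_filter.mpr ⟨Finset.mem_of_mem_erase (mem_of_reachable hx huB), hx⟩
  have hv : v ∉ B₂ := fun hv =>
    absurd (mem_of_reachable (Finset.mem_filter.mp hv).2 huB) (Finset.notMem_erase v B)
  refine ⟨u, B \ B₂, B₂, hu.1, ⟨Finset.mem_sdiff.mpr ⟨h.1, hv⟩, ?_⟩, ⟨hmem .rfl, ?_⟩,
    Finset.sdiff_disjoint, Finset.sdiff_union_of_subset (Finset.filter_subset _ _)⟩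
  · intro x hx
    have hvx := h.2 x (Finset.mem_sdiff.mp hx).1
    rw [SimpleGraph.reachable_iff_reflTransGen] at hvx
    induction hvx with
    | refl => exact .rfl
    | @tail y z _ hyz ih =>
      by_cases hzv : z = v
      · rw [hzv]
      by_cases hy : y ∈ B₂
      · refine absurd (hmem ((Finset.mem_filter.mp hy).2.trans ?_)) (Finset.mem_sdiff.mp hx).2
        exact reachable_of_adj hyz.1
          (mem_of_reachable (Finset.mem_filter.mp hy).2 huB) (Finset.mem_erase.mpr ⟨hzv, hyz.2.2⟩)
      · have hy' : y ∈ B \ B₂ := Finset.mem_sdiff.mpr ⟨hyz.2.1, hy⟩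
        exact (ih hy').trans (reachable_of_adj hyz.1 hy' hx)
  · intro x hx
    have hux := (Finset.mem_filter.mp hx).2
    rw [SimpleGraph.reachable_iff_reflTransGen] at hux
    clear hx
    induction hux with
    | refl => exact .rfl
    | @tail y z h1 h2 ih =>
      rw [← SimpleGraph.reachable_iff_reflTransGen] at h1
      exact ih.trans (reachable_of_adj h2.1 (hmem h1) (hmem (h1.trans h2.reachable)))

/-- A connected set that contains `S` stays connected when a set is added whose components all
meet `S`. -/
theorem Rooted.union_anchored {S U : Finset V} {v : V} (h : Rooted G B v) (hS : S ⊆ B)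
    (hU : Anchored G S U) : Rooted G (B ∪ U) v := by
  refine ⟨Finset.mem_union_left _ h.1, fun x hx => ?_⟩
  rcases Finset.mem_union.mp hx with hx | hx
  · exact reachable_mono Finset.subset_union_left (h.2 x hx)
  · obtain ⟨s, hs, hxs⟩ := hU x hx
    exact (reachable_mono Finset.subset_union_left (h.2 s (hS hs))).trans
      (reachable_mono Finset.subset_union_right hxs).symm

end Rooted

/-! ### Exact solutions by dynamic programming over sets of terminals -/

/-- The numbers `b v` are distinct powers of two, below `2 ^ κ`, for the `κ` elements `v` of `A`,
and zero elsewhere. -/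
structure IsBits {V : Type*} (b : V → ℕ) (A : Finset V) (κ : ℕ) : Prop where
  pow : ∀ v ∈ A, ∃ i < κ, b v = 2 ^ i
  zero : ∀ v, v ∉ A → b v = 0
  surj : ∀ i < κ, ∃ v ∈ A, b v = 2 ^ i
  inj : ∀ v ∈ A, ∀ w ∈ A, b v = b w → v = w
  card : A.card = κ

/-- The bits of `X` are exactly those of the numbers `b v` with `v ∈ B`. -/
def IsMask (b : V → ℕ) (B : Finset V) (X : ℕ) : Prop :=
  ∀ i, X.testBit i = true ↔ ∃ v ∈ B, (b v).testBit i = true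

/-- The bits of `X` are among those of the numbers `b v` with `v ∈ F`. -/
def Covers (b : V → ℕ) (F : Finset V) (X : ℕ) : Prop :=
  ∀ i, X.testBit i = true → ∃ v ∈ F, (b v).testBit i = true

section DynamicProgram

variable {V : Type*} {G : SimpleGraph V} {b : V → ℕ} {A : Finset V} {κ : ℕ}

theorem IsBits.lt (h : IsBits b A κ) (v : V) : b v < 2 ^ κ := by
  by_cases hv : v ∈ A
  · obtain ⟨i, hi, hb⟩ := h.pow v hv
    exact hb ▸ Nat.pow_lt_pow_right (by norm_num) hi
  · rw [h.zero v hv]; positivity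

theorem IsBits.covers_univ [Fintype V] (h : IsBits b A κ) {X : ℕ} (hX : X < 2 ^ κ) :
    Covers b Finset.univ X := by
  intro i hi
  have hiκ : i < κ := by
    by_contra hcon
    rw [Nat.testBit_lt_two_pow (hX.trans_le (Nat.pow_le_pow_right (by norm_num)
      (not_lt.mp hcon)))] at hi
    exact absurd hi (by simp)
  obtain ⟨v, _, hv⟩ := h.surj i hiκ
  exact ⟨v, Finset.mem_univ v, by rw [hv, Nat.testBit_two_pow_self]⟩

theorem IsBits.eq_of_isMask (h : IsBits b A κ) {B : Finset V} (hA : A ⊆ B) {X : ℕ}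
    (hX : X < 2 ^ κ) (hm : IsMask b B X) : X = 2 ^ κ - 1 := by
  refine Nat.eq_of_testBit_eq fun i => ?_
  rw [Nat.testBit_two_pow_sub_one]
  by_cases hi : i < κ
  · obtain ⟨v, hv, hb⟩ := h.surj i hi
    rw [(hm i).mpr ⟨v, hA hv, by rw [hb, Nat.testBit_two_pow_self]⟩]
    simp [hi]
  · rw [Nat.testBit_lt_two_pow (hX.trans_le (Nat.pow_le_pow_right (by norm_num) (not_lt.mp hi)))]
    simp [hi]

variable [DecidableEq V]

theorem IsBits.insert (h : IsBits b A κ) {w : V} (hw : w ∉ A) :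
    IsBits (Function.update b w (2 ^ κ)) (insert w A) (κ + 1) := by
  have hne : ∀ v ∈ A, v ≠ w := fun v hv hvw => hw (hvw ▸ hv)
  have hlt : ∀ v ∈ A, b v ≠ 2 ^ κ := fun v _ => (h.lt v).ne
  constructor
  · intro v hv
    rcases Finset.mem_insert.mp hv with rfl | hv
    · exact ⟨κ, by omega, by simp⟩
    · obtain ⟨i, hi, hb⟩ := h.pow v hv
      exact ⟨i, by omega, by simp [hne v hv, hb]⟩
  · intro v hv
    rw [Finset.mem_insert, not_or] at hv
    simp [hv.1, h.zero v hv.2]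
  · intro i hi
    rcases Nat.lt_succ_iff_lt_or_eq.mp hi with hi | rfl
    · obtain ⟨v, hv, hb⟩ := h.surj i hi
      exact ⟨v, Finset.mem_insert_of_mem hv, by simp [hne v hv, hb]⟩
    · exact ⟨w, Finset.mem_insert_self _ _, by simp⟩
  · intro u hu v hv huv
    rcases Finset.mem_insert.mp hu with hu | hu <;> rcases Finset.mem_insert.mp hv with hv | hv
    · rw [hu, hv]
    · rw [hu, Function.update_self, Function.update_of_ne (hne v hv)] at huv
      exact absurd huv.symm (hlt v hv)
    · rw [hv, Function.update_self, Function.update_of_ne (hne u hu)] at huv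
      exact absurd huv (hlt u hu)
    · simp only [Function.update_of_ne (hne u hu), Function.update_of_ne (hne v hv)] at huv
      exact h.inj u hu v hv huv
  · rw [Finset.card_insert_of_notMem hw, h.card]

theorem IsMask.union {B C : Finset V} {X Y : ℕ} (h : IsMask b B X) (h' : IsMask b C Y) :
    IsMask b (B ∪ C) (X ||| Y) := by
  intro i
  rw [Nat.testBit_or, Bool.or_eq_true, h i, h' i]
  simp only [Finset.mem_union, or_and_right, exists_or]

theorem Covers.union {B C : Finset V} {X Y : ℕ} (h : Covers b B X) (h' : Covers b C Y) :
    Covers b (B ∪ C) (X ||| Y) := by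
  intro i hi
  rw [Nat.testBit_or, Bool.or_eq_true] at hi
  rcases hi with hi | hi
  · obtain ⟨v, hv, hb⟩ := h i hi
    exact ⟨v, Finset.mem_union_left _ hv, hb⟩
  · obtain ⟨v, hv, hb⟩ := h' i hi
    exact ⟨v, Finset.mem_union_right _ hv, hb⟩

theorem IsBits.subset_of_covers (h : IsBits b A κ) {F : Finset V}
    (hF : Covers b F (2 ^ κ - 1)) : A ⊆ F := by
  intro v hv
  obtain ⟨i, hi, hb⟩ := h.pow v hv
  obtain ⟨w, hw, hwi⟩ := hF i (by rw [Nat.testBit_two_pow_sub_one]; simpa using hi)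
  have hwA : w ∈ A := by
    by_contra hcon
    rw [h.zero w hcon, Nat.zero_testBit] at hwi
    exact absurd hwi (by simp)
  obtain ⟨j, _, hbj⟩ := h.pow w hwA
  rw [hbj, Nat.testBit_two_pow] at hwi
  have hji : j = i := by simpa using hwi
  rwa [h.inj v hv w hwA (by rw [hb, hbj, hji])]

/-- The table `c` of costs is optimal with respect to connected sets of at most `k` vertices:
`c v X` is at most the number of vertices outside of `U`, not counting `v`, in any such set that
contains `v` and whose terminals are those encoded by `X`. -/
def BestUpTo (G : SimpleGraph V) (U : Finset V) (b : V → ℕ) (κ : ℕ) (c : V → ℕ → ℕ) (k : ℕ) :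
    Prop :=
  ∀ B v, Rooted G B v → B.card ≤ k →
    ∃ X < 2 ^ κ, IsMask b B X ∧ c v X ≤ (B \ insert v U).card

theorem BestUpTo.zero (U : Finset V) (c : V → ℕ → ℕ) : BestUpTo G U b κ c 0 := by
  intro B v h hB
  exact absurd h.1 (by simp [Finset.card_eq_zero.mp (Nat.le_zero.mp hB)])

/-- One round of relaxations extends the optimality to sets with one more vertex. -/
theorem BestUpTo.succ {U : Finset V} {c c' : V → ℕ → ℕ} {k : ℕ} (hb : IsBits b A κ)
    (h : BestUpTo G U b κ c k) (h0 : ∀ v, c' v (b v) = 0)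
    (hrel : ∀ X < 2 ^ κ, ∀ Y < 2 ^ κ, ∀ v u, G.Adj v u →
      c' v (X ||| Y) ≤ c v X + c u Y + (if u ∈ U then 0 else 1)) :
    BestUpTo G U b κ c' (k + 1) := by
  intro B v hB hcard
  by_cases hBv : B = {v}
  · subst hBv
    exact ⟨b v, hb.lt v, fun i => by simp, by simp [h0]⟩
  obtain ⟨u, B₁, B₂, huv, h1, h2, hdisj, rfl⟩ := hB.split hBv
  rw [Finset.card_union_of_disjoint hdisj] at hcard
  have hp1 : 0 < B₁.card := Finset.card_pos.mpr ⟨v, h1.1⟩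
  have hp2 : 0 < B₂.card := Finset.card_pos.mpr ⟨u, h2.1⟩
  obtain ⟨X, hX, hXm, hXc⟩ := h B₁ v h1 (by omega)
  obtain ⟨Y, hY, hYm, hYc⟩ := h B₂ u h2 (by omega)
  refine ⟨X ||| Y, Nat.or_lt_two_pow hX hY, hXm.union hYm, (hrel X hX Y hY v u huv).trans ?_⟩
  have hv2 : v ∉ B₂ := Finset.disjoint_left.mp hdisj h1.1
  have e1 : (B₁ ∪ B₂) \ insert v U = (B₁ \ insert v U) ∪ (B₂ \ U) := by
    ext x
    simp only [Finset.mem_sdiff, Finset.mem_union, Finset.mem_insert, not_or]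
    constructor
    · rintro ⟨hx | hx, h3, h4⟩
      · exact .inl ⟨hx, h3, h4⟩
      · exact .inr ⟨hx, h4⟩
    · rintro (⟨hx, h3, h4⟩ | ⟨hx, h4⟩)
      · exact ⟨.inl hx, h3, h4⟩
      · exact ⟨.inr hx, fun e => hv2 (e ▸ hx), h4⟩
  rw [e1, Finset.card_union_of_disjoint (hdisj.mono Finset.sdiff_subset Finset.sdiff_subset)]
  have e2 : (B₂ \ insert u U).card + (if u ∈ U then 0 else 1) ≤ (B₂ \ U).card := by
    by_cases hu : u ∈ U
    · simp [hu]
    · have : B₂ \ insert u U = (B₂ \ U).erase u := by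
        ext x; simp only [Finset.mem_sdiff, Finset.mem_insert, Finset.mem_erase, not_or]; tauto
      rw [this, if_neg hu, Finset.card_erase_add_one (Finset.mem_sdiff.mpr ⟨h2.1, hu⟩)]
  omega

end DynamicProgram

/-- The set of vertices that is encoded by the bits of the number `m`. -/
def bitSet {n : ℕ} (m : ℕ) : Finset (Fin n) := Finset.univ.filter fun v => m.testBit v = true

theorem mem_bitSet {n m : ℕ} {v : Fin n} : v ∈ (bitSet m : Finset (Fin n)) ↔ m.testBit v = true := by
  simp [bitSet]

theorem bitSet_or {n : ℕ} (m m' : ℕ) : (bitSet (m ||| m') : Finset (Fin n)) = bitSet m ∪ bitSet m' := by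
  ext v; simp [mem_bitSet]

theorem bitSet_two_pow {n : ℕ} (v : Fin n) : (bitSet (2 ^ (v : ℕ)) : Finset (Fin n)) = {v} := by
  ext u
  simp [mem_bitSet, Nat.testBit_two_pow, Fin.ext_iff, eq_comm]

theorem bitSet_full {n : ℕ} : (bitSet (2 ^ n - 1) : Finset (Fin n)) = Finset.univ := by
  ext u
  simp [mem_bitSet]

/-- What the tables hold for the root `v` and the terminals encoded by `X`: a connected set,
encoded by `f`, that contains `v` and these terminals, and a bound `c` for its number of vertices
outside of `U`, not counting `v`. -/
structure Entry {n : ℕ} (G : SimpleGraph (Fin n)) (U : Finset (Fin n)) (b : Fin n → ℕ) (f c : ℕ)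
    (v : Fin n) (X : ℕ) : Prop where
  lt : f < 2 ^ n
  rooted : Rooted G (bitSet f) v
  covers : Covers b (bitSet f) X
  card_le : (bitSet f \ insert v U).card ≤ c

theorem Entry.full {n κ : ℕ} {G : SimpleGraph (Fin n)} (hG : G.Connected) (U : Finset (Fin n))
    {b : Fin n → ℕ} {A : Finset (Fin n)} (hb : IsBits b A κ) (v : Fin n) {X : ℕ}
    (hX : X < 2 ^ κ) : Entry G U b (2 ^ n - 1) n v X where
  lt := Nat.sub_lt (by positivity) (by norm_num)
  rooted := by
    rw [bitSet_full]
    refine ⟨Finset.mem_univ v, fun x _ => (hG.preconnected v x).mono ?_⟩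
    exact fun a b hab => ⟨hab, Finset.mem_univ _, Finset.mem_univ _⟩
  covers := by rw [bitSet_full]; exact hb.covers_univ hX
  card_le := (Finset.card_le_univ _).trans (by simp)

theorem Entry.single {n : ℕ} (G : SimpleGraph (Fin n)) (U : Finset (Fin n))
    (b : Fin n → ℕ) (v : Fin n) : Entry G U b (2 ^ (v : ℕ)) 0 v (b v) where
  lt := Nat.pow_lt_pow_right (by norm_num) v.isLt
  rooted := by rw [bitSet_two_pow]; exact .singleton v
  covers := by rw [bitSet_two_pow]; exact fun i hi => ⟨v, by simp, hi⟩
  card_le := by rw [bitSet_two_pow]; simp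

theorem Entry.union {n : ℕ} {G : SimpleGraph (Fin n)} {U : Finset (Fin n)} {b : Fin n → ℕ}
    {f f' c c' X Y : ℕ} {v u : Fin n} (h : Entry G U b f c v X) (h' : Entry G U b f' c' u Y)
    (hvu : G.Adj v u) :
    Entry G U b (f ||| f') (c + c' + (if u ∈ U then 0 else 1)) v (X ||| Y) where
  lt := Nat.or_lt_two_pow h.lt h'.lt
  rooted := by rw [bitSet_or]; exact h.rooted.union h'.rooted hvu
  covers := by rw [bitSet_or]; exact h.covers.union h'.covers
  card_le := by
    have h1 : (bitSet (f ||| f') \ insert v U : Finset (Fin n))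
        ⊆ (bitSet f \ insert v U) ∪ ((bitSet f' \ insert u U) ∪ (if u ∈ U then ∅ else {u})) := by
      intro x hx
      rw [bitSet_or] at hx
      by_cases hu : u ∈ U <;> by_cases hxu : x = u <;>
        simp_all only [Finset.mem_sdiff, Finset.mem_union, Finset.mem_insert, if_true, if_false,
          Finset.mem_singleton] <;> tauto
    refine (Finset.card_le_card h1).trans ((Finset.card_union_le _ _).trans ?_)
    have h2 := Finset.card_union_le (bitSet f' \ insert u U) (if u ∈ U then ∅ else {u})
    have h3 : (if u ∈ U then (∅ : Finset (Fin n)) else {u}).card = if u ∈ U then 0 else 1 := by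
      split_ifs <;> simp
    have := h.card_le
    have := h'.card_le
    omega

end DenseSteiner

/-! ### Programs: notation, tables, bitwise operations and division -/

namespace RAM

@[simp] theorem State.setVar_var (σ : State) (x k z : ℕ) :
    (σ.setVar x k).var z = if z = x then k else σ.var z := by
  simp [State.setVar, Function.update_apply]

@[simp] theorem State.setVar_arr (σ : State) (x k : ℕ) : (σ.setVar x k).arr = σ.arr := rfl

@[simp] theorem State.setArr_var (σ : State) (a i k : ℕ) : (σ.setArr a i k).var = σ.var := rfl

@[simp] theorem State.setArr_arr (σ : State) (a i k b j : ℕ) :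
    (σ.setArr a i k).arr b j = if b = a ∧ j = i then k else σ.arr b j := by
  by_cases hb : b = a
  · subst hb
    simp [State.setArr, Function.update_apply]
  · simp [State.setArr, hb]

instance : Add Exp := ⟨.add⟩
instance : Sub Exp := ⟨.sub⟩
instance : Coe ℕ Exp := ⟨.var⟩

@[simp] theorem Exp.val_add (σ : State) (e f : Exp) : (e + f).val σ = e.val σ + f.val σ := rfl
@[simp] theorem Exp.val_sub (σ : State) (e f : Exp) : (e - f).val σ = e.val σ - f.val σ := rfl
@[simp] theorem Exp.val_half (σ : State) (e : Exp) : (half e).val σ = e.val σ / 2 := rfl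
@[simp] theorem Exp.val_const (σ : State) (k : ℕ) : (const k).val σ = k := rfl
@[simp] theorem Exp.val_var (σ : State) (x : ℕ) : (var x).val σ = σ.var x := rfl
@[simp] theorem Exp.val_read (σ : State) (a : ℕ) (e : Exp) :
    (read a e).val σ = σ.arr a (e.val σ) := rfl

/-- An expression that is nonzero if and only if `e` and `f` have different values. -/
def Exp.ne (e f : Exp) : Exp := (e - f) + (f - e)

@[simp] theorem Exp.val_ne_eq_zero (σ : State) (e f : Exp) :
    (e.ne f).val σ = 0 ↔ e.val σ = f.val σ := by
  simp only [Exp.ne, Exp.val_add, Exp.val_sub]; omega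

/-- The lowest bit of `e`. -/
def Exp.odd (e : Exp) : Exp := e - (half e + half e)

@[simp] theorem Exp.val_odd (σ : State) (e : Exp) : e.odd.val σ = e.val σ % 2 := by
  simp only [Exp.odd, Exp.val_add, Exp.val_sub, Exp.val_half]; omega

@[simp] theorem wp_assign (y x : ℕ) (e : Exp) (Q : State → Prop) (σ : State) :
    (Prog.assign x e).wp y Q σ ↔ Q (σ.setVar x (e.val σ)) := Iff.rfl
@[simp] theorem wp_write (y a : ℕ) (i e : Exp) (Q : State → Prop) (σ : State) :
    (Prog.write a i e).wp y Q σ ↔ Q (σ.setArr a (i.val σ) (e.val σ)) := Iff.rfl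
@[simp] theorem wp_skip (y : ℕ) (Q : State → Prop) (σ : State) :
    Prog.skip.wp y Q σ ↔ Q σ := Iff.rfl
theorem wp_seq (y : ℕ) (P P' : Prog) (Q : State → Prop) (σ : State) :
    (Prog.seq P P').wp y Q σ ↔ P.wp y (P'.wp y Q) σ := Iff.rfl
theorem wp_cond (y : ℕ) (e : Exp) (P P' : Prog) (Q : State → Prop) (σ : State) :
    (Prog.cond e P P').wp y Q σ ↔
      (e.val σ ≠ 0 → P.wp y Q σ) ∧ (e.val σ = 0 → P'.wp y Q σ) := Iff.rfl

/-- Sequential composition, where the first program is given by its specification. -/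
theorem wp_seq_of {y : ℕ} {P P' : Prog} {R Q : State → Prop} {σ : State} (h : P.wp y R σ)
    (h' : ∀ τ, Frame P σ τ → R τ → P'.wp y Q τ) : (Prog.seq P P').wp y Q σ := by
  rw [wp_seq]
  exact Prog.wp_mono (Prog.wp_frame h) fun τ hτ => h' τ hτ.2 hτ.1

end RAM

namespace DenseSteiner

open RAM

infixr:60 " ;; " => RAM.Prog.seq
notation:65 x:66 " ≔ " e:66 => RAM.Prog.assign x e
notation:65 a:66 "⟪" i "⟫" " ≔ " e:66 => RAM.Prog.write a i e
notation:max a:max "⟪" i "⟫" => RAM.Exp.read a i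

/-! The variables of the program. -/
notation "x_n" => (0 : ℕ)
notation "x_num" => (1 : ℕ)
notation "x_den" => (2 : ℕ)
notation "x_t" => (3 : ℕ)
notation "x_q" => (4 : ℕ)
notation "x_g" => (5 : ℕ)
notation "x_k" => (6 : ℕ)
notation "x_s" => (7 : ℕ)
notation "x_u" => (8 : ℕ)
notation "x_v" => (9 : ℕ)
notation "x_w" => (10 : ℕ)
notation "x_z" => (11 : ℕ)
notation "x_lu" => (12 : ℕ)
notation "x_lv" => (13 : ℕ)
notation "x_flag" => (14 : ℕ)
notation "x_cnt" => (15 : ℕ)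
notation "x_hit" => (16 : ℕ)
notation "x_cand" => (17 : ℕ)
notation "x_pw" => (18 : ℕ)
notation "x_root" => (19 : ℕ)
notation "x_X" => (20 : ℕ)
notation "x_Y" => (21 : ℕ)
notation "x_a" => (22 : ℕ)
notation "x_b" => (23 : ℕ)
notation "x_p" => (24 : ℕ)
notation "x_or" => (25 : ℕ)
notation "x_msk" => (26 : ℕ)
notation "x_f" => (27 : ℕ)
notation "x_i" => (28 : ℕ)

/-! The arrays of the program. -/
notation "a_adj" => (0 : ℕ)
notation "a_term" => (1 : ℕ)
notation "a_tree" => (2 : ℕ)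
notation "a_set" => (3 : ℕ)
notation "a_row" => (4 : ℕ)
notation "a_lab" => (5 : ℕ)
notation "a_bit" => (6 : ℕ)
notation "a_fam" => (7 : ℕ)
notation "a_cost" => (8 : ℕ)
notation "a_off" => (9 : ℕ)
notation "a_pow" => (10 : ℕ)

/-- Fills the array `a` with the multiples of the value of the variable `c`. -/
def fillMultiples (a c : ℕ) : Prog :=
  a⟪.const 0⟫ ≔ .const 0 ;; forTo x_v x_n (a⟪x_v + .const 1⟫ ≔ (a⟪x_v⟫ + c))

theorem wp_fillMultiples {y a c n k : ℕ} {σ : State} {Q : State → Prop} (hn : σ.var x_n = n)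
    (hny : n ≤ y) (hc : σ.var c = k) (hcv : c ≠ x_v)
    (hQ : ∀ τ, Frame (fillMultiples a c) σ τ → (∀ v ≤ n, τ.arr a v = v * k) → Q τ) :
    (fillMultiples a c).wp y Q σ := by
  suffices h : (fillMultiples a c).wp y (fun τ => ∀ v ≤ n, τ.arr a v = v * k) σ from
    Prog.wp_mono (Prog.wp_frame h) fun τ hτ => hQ τ hτ.2 hτ.1
  simp only [fillMultiples, wp_seq, wp_write, Exp.val_const]
  refine wp_forTo (fun j ρ => ∀ v ≤ j, ρ.arr a v = v * k) (m := n) (by simpa using hn) hny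
    (by decide) rfl rfl (fun _ _ _ h => h) ?_ ?_ (fun _ _ h => h)
  · intro v hv
    simp [Nat.le_zero.mp hv]
  · intro j ρ hj hF hv hI
    have hck : ρ.var c = k := (hF.var c (by simp [forTo, Prog.modVar, hcv])).trans hc
    simp only [wp_write, Exp.val_add, Exp.val_read, Exp.val_var, Exp.val_const, hv, hck]
    intro v hvj
    rcases Nat.le_succ_iff.mp hvj with h | rfl
    · rw [State.setArr_arr, if_neg (by omega), hI v h]
    · rw [State.setArr_arr, if_pos (by simp), hI j le_rfl, Nat.succ_mul]

/-- Fills the array `a_pow` with the powers of two. -/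
def fillPowers : Prog :=
  a_pow⟪.const 0⟫ ≔ .const 1 ;; forTo x_v x_n (a_pow⟪x_v + .const 1⟫ ≔ (a_pow⟪x_v⟫ + a_pow⟪x_v⟫))

theorem wp_fillPowers {y n : ℕ} {σ : State} {Q : State → Prop} (hn : σ.var x_n = n)
    (hny : n ≤ y)
    (hQ : ∀ τ, Frame fillPowers σ τ → (∀ v ≤ n, τ.arr a_pow v = 2 ^ v) → Q τ) :
    fillPowers.wp y Q σ := by
  suffices h : fillPowers.wp y (fun τ => ∀ v ≤ n, τ.arr a_pow v = 2 ^ v) σ from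
    Prog.wp_mono (Prog.wp_frame h) fun τ hτ => hQ τ hτ.2 hτ.1
  simp only [fillPowers, wp_seq, wp_write, Exp.val_const]
  refine wp_forTo (fun j ρ => ∀ v ≤ j, ρ.arr a_pow v = 2 ^ v) (m := n) (by simpa using hn) hny
    (by decide) rfl rfl (fun _ _ _ h => h) ?_ ?_ (fun _ _ h => h)
  · intro v hv
    simp [Nat.le_zero.mp hv]
  · intro j ρ hj hF hv hI
    simp only [wp_write, Exp.val_add, Exp.val_read, Exp.val_var, Exp.val_const, hv]
    intro v hvj
    rcases Nat.le_succ_iff.mp hvj with h | rfl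
    · rw [State.setArr_arr, if_neg (by omega), hI v h]
    · rw [State.setArr_arr, if_pos (by simp), hI j le_rfl, Nat.pow_succ, Nat.mul_two]

/-- Computes the bitwise disjunction of `x_a` and `x_b` in `x_or`. -/
def bitOr : Prog :=
  x_or ≔ .const 0 ;; x_p ≔ .const 1 ;;
  .loop (x_a + x_b)
    (.cond (Exp.odd x_a + Exp.odd x_b) (x_or ≔ (x_or + x_p)) .skip ;;
      x_a ≔ .half x_a ;; x_b ≔ .half x_b ;; x_p ≔ (x_p + x_p))

theorem or_eq_two_mul_add (a b : ℕ) :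
    a ||| b = 2 * (a / 2 ||| b / 2) + (if a % 2 + b % 2 = 0 then 0 else 1) := by
  have h1 : (a ||| b) / 2 = a / 2 ||| b / 2 := Nat.or_div_two
  have h2 : (a ||| b) % 2 = 1 ↔ a % 2 = 1 ∨ b % 2 = 1 := Nat.or_mod_two_eq_one
  rw [← h1]
  split_ifs with h <;> omega

theorem wp_bitOr {y k : ℕ} {σ : State} {Q : State → Prop} (hky : k ≤ y)
    (ha : σ.var x_a < 2 ^ k) (hb : σ.var x_b < 2 ^ k)
    (hQ : ∀ τ, Frame bitOr σ τ → τ.var x_or = (σ.var x_a ||| σ.var x_b) → Q τ) :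
    bitOr.wp y Q σ := by
  suffices h : bitOr.wp y (fun τ => τ.var x_or = (σ.var x_a ||| σ.var x_b)) σ from
    Prog.wp_mono (Prog.wp_frame h) fun τ hτ => hQ τ hτ.2 hτ.1
  simp only [bitOr, wp_seq, wp_assign, Exp.val_const]
  refine Prog.wp_loop (fun j ρ => ρ.var x_a < 2 ^ j ∧ ρ.var x_b < 2 ^ j ∧
    ρ.var x_or + ρ.var x_p * (ρ.var x_a ||| ρ.var x_b) = (σ.var x_a ||| σ.var x_b)) hky ?_ ?_ ?_
  · simp [ha, hb]
  · rintro j ρ hF ⟨h1, h2, h3⟩ he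
    simp only [Exp.val_add, Exp.val_var] at he
    have hj : j ≠ 0 := by
      rintro rfl
      simp only [pow_zero] at h1 h2
      omega
    obtain ⟨j, rfl⟩ := Nat.exists_eq_succ_of_ne_zero hj
    rw [Nat.succ_eq_add_one, Nat.pow_succ] at h1 h2
    refine ⟨j, Nat.lt_succ_self j, ?_⟩
    rw [or_eq_two_mul_add] at h3
    simp only [wp_seq, wp_cond, wp_assign, wp_skip, Exp.val_add, Exp.val_odd, Exp.val_var,
      Exp.val_half, State.setVar_var, ne_eq]
    refine ⟨fun h => ?_, fun h => ?_⟩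
    · rw [if_neg h] at h3
      norm_num
      exact ⟨by omega, by omega, by rw [← h3]; ring⟩
    · rw [if_pos h] at h3
      norm_num
      exact ⟨by omega, by omega, by rw [← h3]; ring⟩
  · rintro j ρ hF ⟨h1, h2, h3⟩ he
    simp only [Exp.val_add, Exp.val_var] at he
    have ha0 : ρ.var x_a = 0 := by omega
    have hb0 : ρ.var x_b = 0 := by omega
    simpa [ha0, hb0] using h3

/-- Computes in `x` the least `j ≥ 1` such that `A ≤ j * B` or `n ≤ j`. -/
def divide (x : ℕ) (A B : Exp) : Prog :=
  x ≔ .const 1 ;; x_s ≔ B ;;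
  .loop ((A - x_s) - ((A - x_s) - (x_n - (x : Exp)))) (x_s ≔ (x_s + B) ;; x ≔ (x + .const 1))

theorem wp_divide {y x n a b : ℕ} {A B : Exp} {σ : State}
    (hn : σ.var x_n = n) (hny : n ≤ y) (hx : x ≠ x_s) (hxn : x ≠ x_n)
    (hA : ∀ ρ, Frame (divide x A B) σ ρ → A.val ρ = a)
    (hB : ∀ ρ, Frame (divide x A B) σ ρ → B.val ρ = b) :
    (divide x A B).wp y (fun τ => ∃ j, τ.var x = j ∧ 1 ≤ j ∧ (a ≤ j * b ∨ n ≤ j) ∧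
      (j = 1 ∨ (j - 1) * b < a ∧ j ≤ n)) σ := by
  have hmx : (divide x A B).modVar x = true := by simp [divide, Prog.modVar]
  have hms : (divide x A B).modVar x_s = true := by simp [divide, Prog.modVar]
  have hmn : (divide x A B).modVar x_n = false := by simp [divide, Prog.modVar, hxn.symm]
  have hF0 : Frame (divide x A B) σ (σ.setVar x 1) := (Frame.refl _ _).setVar hmx
  have hF1 : Frame (divide x A B) σ ((σ.setVar x 1).setVar x_s b) := hF0.setVar hms
  rw [divide, wp_seq, wp_assign, wp_seq, wp_assign, Exp.val_const, hB _ hF0]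
  refine Prog.wp_loop (fun k ρ => 1 ≤ ρ.var x ∧ ρ.var x_s = ρ.var x * b ∧
    (ρ.var x = 1 ∨ (ρ.var x - 1) * b < a ∧ ρ.var x ≤ n) ∧ k = n - ρ.var x)
    (k := n - 1) (by omega) ?_ ?_ ?_
  · simp [hx]
  · rintro k ρ hF ⟨h1, h2, h3, h4⟩ he
    have hF' : Frame (divide x A B) σ ρ := hF1.trans
      (hF.weaken (by simp +contextual [Prog.modVar, divide])
        (by simp +contextual [Prog.modArr, divide]))
    have hρn := (hF'.var _ hmn).trans hn
    have hFs := hF'.setVar (i := x_s) (k := ρ.var x * b + b) hms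
    simp only [Exp.val_sub, Exp.val_var, hA _ hF', hρn, h2] at he
    refine ⟨n - (ρ.var x + 1), by omega, ?_⟩
    simp only [wp_seq, wp_assign, Exp.val_add, Exp.val_var, Exp.val_const, hB _ hF', h2,
      State.setVar_var, if_true, if_neg hx, if_neg hx.symm]
    refine ⟨by omega, by ring, .inr ⟨?_, by omega⟩, trivial⟩
    rw [Nat.add_sub_cancel]
    omega
  · rintro k ρ hF ⟨h1, h2, h3, h4⟩ he
    have hF' : Frame (divide x A B) σ ρ := hF1.trans
      (hF.weaken (by simp +contextual [Prog.modVar, divide])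
        (by simp +contextual [Prog.modArr, divide]))
    have hρn := (hF'.var _ hmn).trans hn
    simp only [Exp.val_sub, Exp.val_var, hA _ hF', hρn, h2] at he
    exact ⟨_, rfl, h1, by omega, h3⟩

/-! ### Components and a spanning forest -/

open Classical in
/-- The state holds the graph `G`, the offsets of the rows of its adjacency matrix and the powers
of two. -/
structure Ctx {n : ℕ} (G : SimpleGraph (Fin n)) (σ : State) : Prop where
  num : σ.var x_n = n
  row : ∀ v : Fin n, σ.arr a_row v = v * n
  pow : ∀ v ≤ n, σ.arr a_pow v = 2 ^ v
  adj : ∀ u v : Fin n, σ.arr a_adj (u * n + v) = if G.Adj u v then 1 else 0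

/-- The array `a_set` holds the indicator vector of `U`. -/
def HasSet {n : ℕ} (U : Finset (Fin n)) (σ : State) : Prop :=
  ∀ v : Fin n, σ.arr a_set v = if v ∈ U then 1 else 0

open Classical in
/-- The arrays `a_tree` and `a_lab` hold a forest `H` within `U`, and a function `L` that labels
its components by representatives. -/
structure Forest {n : ℕ} (G : SimpleGraph (Fin n)) (U : Finset (Fin n)) (H : SimpleGraph (Fin n))
    (L : Fin n → Fin n) (σ : State) : Prop where
  lab : ∀ v : Fin n, σ.arr a_lab v = L v
  tree : ∀ u v : Fin n, σ.arr a_tree (u * n + v) = if H.Adj u v then 1 else 0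
  acyclic : H.IsAcyclic
  le : H ≤ inside G U
  eq_iff : ∀ u v, L u = L v ↔ H.Reachable u v
  idem : ∀ v, L (L v) = L v

section Frames

variable {n : ℕ} {G : SimpleGraph (Fin n)} {U : Finset (Fin n)} {P : Prog} {σ τ : State}

theorem Ctx.frame (h : Ctx G σ) (hF : Frame P σ τ) (h0 : P.modVar x_n = false)
    (h1 : P.modArr a_row = false) (h2 : P.modArr a_pow = false) (h3 : P.modArr a_adj = false) :
    Ctx G τ where
  num := (hF.var _ h0).trans h.num
  row v := by rw [hF.arr _ h1]; exact h.row v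
  pow v hv := by rw [hF.arr _ h2]; exact h.pow v hv
  adj u v := by rw [hF.arr _ h3]; exact h.adj u v

theorem HasSet.frame (h : HasSet U σ) (hF : Frame P σ τ) (h0 : P.modArr a_set = false) :
    HasSet U τ := fun v => by rw [hF.arr _ h0]; exact h v

theorem Forest.frame {H : SimpleGraph (Fin n)} {L : Fin n → Fin n} (h : Forest G U H L σ)
    (hF : Frame P σ τ) (h0 : P.modArr a_lab = false) (h1 : P.modArr a_tree = false) :
    Forest G U H L τ :=
  { h with
    lab := fun v => by rw [hF.arr _ h0]; exact h.lab v
    tree := fun u v => by rw [hF.arr _ h1]; exact h.tree u v }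

end Frames

theorem cell_inj {m a b c d : ℕ} (hb : b < m) (hd : d < m) :
    a * m + b = c * m + d ↔ a = c ∧ b = d := by
  refine ⟨fun h => ?_, fun ⟨h1, h2⟩ => by rw [h1, h2]⟩
  have h1 : (a * m + b) / m = a := by
    rw [Nat.mul_comm, Nat.mul_add_div (by omega), Nat.div_eq_of_lt hb, Nat.add_zero]
  have h2 : (c * m + d) / m = c := by
    rw [Nat.mul_comm, Nat.mul_add_div (by omega), Nat.div_eq_of_lt hd, Nat.add_zero]
  have h3 : a = c := by rw [← h1, ← h2, h]
  subst h3
  exact ⟨rfl, by omega⟩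

/-- Joining two trees of a forest by an edge, and relabelling one of them accordingly. -/
theorem join_eq_iff_reachable {V : Type*} [DecidableEq V] {H : SimpleGraph V} {L : V → V}
    (hL : ∀ a b, L a = L b ↔ H.Reachable a b) (u v : V) (a b : V) :
    (if L a = L u then L v else L a) = (if L b = L u then L v else L b) ↔
      (H ⊔ SimpleGraph.edge u v).Reachable a b := by
  have hle : ∀ {a b}, L a = L b → (H ⊔ SimpleGraph.edge u v).Reachable a b := fun h =>
    ((hL _ _).mp h).mono le_sup_left
  have huv : (H ⊔ SimpleGraph.edge u v).Reachable u v := by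
    by_cases h : u = v
    · rw [h]
    · exact SimpleGraph.Adj.reachable (.inr (by simp [SimpleGraph.edge_adj, h]))
  constructor
  · intro h
    split_ifs at h with h1 h2 h2
    · exact hle (h1.trans h2.symm)
    · exact (hle h1).trans (huv.trans (hle h))
    · exact (hle h).trans (huv.symm.trans (hle h2.symm))
    · exact hle h
  · intro h
    rw [SimpleGraph.reachable_iff_reflTransGen] at h
    induction h with
    | refl => rfl
    | @tail c d _ hcd ih =>
      rw [ih]
      rcases hcd with hcd | hcd
      · rw [(hL c d).mpr hcd.reachable]
      · rw [SimpleGraph.edge_adj] at hcd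
        rcases hcd.1 with ⟨rfl, rfl⟩ | ⟨rfl, rfl⟩ <;> simp

/-- Adds the edge between `x_u` and `x_v` to the forest, unless it would close a cycle. -/
def joinTrees : Prog :=
  x_lu ≔ a_lab⟪x_u⟫ ;; x_lv ≔ a_lab⟪x_v⟫ ;;
  .cond (Exp.ne x_lu x_lv)
    (a_tree⟪a_row⟪x_u⟫ + x_v⟫ ≔ .const 1 ;; a_tree⟪a_row⟪x_v⟫ + x_u⟫ ≔ .const 1 ;;
      forTo x_z x_n (.cond (Exp.ne a_lab⟪x_z⟫ x_lu) .skip (a_lab⟪x_z⟫ ≔ x_lv)))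
    .skip

/-- `τ` refines the partition of the vertices by labels less than `σ` does. -/
def CoarserLabels (n : ℕ) (σ τ : State) : Prop :=
  ∀ a b : Fin n, σ.arr a_lab a = σ.arr a_lab b → τ.arr a_lab a = τ.arr a_lab b

theorem wp_joinTrees {y n : ℕ} {G : SimpleGraph (Fin n)} {U : Finset (Fin n)} {σ : State}
    (hny : n ≤ y) (hC : Ctx G σ) (hJ : ∃ H L, Forest G U H L σ) {u v : Fin n}
    (hu : σ.var x_u = u) (hv : σ.var x_v = v) (huv : (inside G U).Adj u v) :
    joinTrees.wp y (fun τ => (∃ H L, Forest G U H L τ) ∧ CoarserLabels n σ τ ∧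
      τ.arr a_lab u = τ.arr a_lab v) σ := by
  classical
  obtain ⟨H, L, hJ⟩ := hJ
  simp only [joinTrees, wp_seq, wp_assign, wp_cond, wp_write, wp_skip, Exp.val_read, Exp.val_var,
    Exp.val_const, Exp.val_add, ne_eq, Exp.val_ne_eq_zero, hu, hv, hJ.lab,
    State.setVar_var, State.setVar_arr, State.setArr_arr, State.setArr_var]
  norm_num [hv, hJ.lab, hC.row, Fin.val_inj]
  refine ⟨fun hne => ?_, fun heq => ⟨⟨H, L, hJ.lab, hJ.tree, hJ.acyclic, hJ.le, hJ.eq_iff,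
    hJ.idem⟩, fun a b h => h, heq⟩⟩
  refine wp_forTo (fun j ρ => (∀ z : Fin n, ρ.arr a_lab z =
      if (z : ℕ) < j ∧ L z = L u then (L v : ℕ) else L z)) (m := n) (by simpa using hC.num) hny
    (by decide) rfl rfl (fun _ _ _ h => h) (fun z => by simp [hJ.lab]) ?_ ?_
  · intro j ρ hj hF hz hI
    have hlu : ρ.var x_lu = L u := by rw [hF.var x_lu rfl]; simp
    have hlv : ρ.var x_lv = L v := by rw [hF.var x_lv rfl]; simp
    obtain ⟨w, rfl⟩ : ∃ w : Fin n, (w : ℕ) = j := ⟨⟨j, hj⟩, rfl⟩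
    have hw : ρ.arr a_lab w = L w := by rw [hI]; simp
    simp only [wp_cond, wp_skip, wp_write, ne_eq, Exp.val_ne_eq_zero, Exp.val_read, Exp.val_var,
      hz, hw, hlu, hlv, State.setArr_arr, Fin.val_inj]
    refine ⟨fun h z => ?_, fun h z => ?_⟩
    · rw [hI z]
      by_cases hzw : z = w
      · subst hzw; simp [h]
      · have : (z : ℕ) ≠ w := fun e => hzw (Fin.ext e)
        simp only [show (z : ℕ) < w + 1 ↔ (z : ℕ) < w by omega]
    · by_cases hzw : z = w
      · subst hzw; simp [h]
      · have : (z : ℕ) ≠ w := fun e => hzw (Fin.ext e)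
        simp only [hzw, and_false, if_false, hI z, show (z : ℕ) < w + 1 ↔ (z : ℕ) < w by omega]
  · intro ρ hF hI
    have hlab : ∀ z : Fin n, ρ.arr a_lab z = ((if L z = L u then L v else L z : Fin n) : ℕ) := by
      intro z
      rw [hI z]
      split_ifs <;> simp_all
    refine ⟨⟨H ⊔ SimpleGraph.edge u v, fun z => if L z = L u then L v else L z, hlab, ?_, ?_, ?_,
      join_eq_iff_reachable hJ.eq_iff u v, ?_⟩, ?_, ?_⟩
    · intro a b
      rw [hF.arr a_tree rfl]
      simp only [State.setArr_arr, true_and, cell_inj b.isLt u.isLt, cell_inj b.isLt v.isLt,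
        State.setVar_arr, hJ.tree,
        SimpleGraph.sup_adj, SimpleGraph.edge_adj, Fin.val_inj]
      have := huv.1.ne
      by_cases h1 : a = v ∧ b = u
      · obtain ⟨rfl, rfl⟩ := h1
        simp [this.symm]
      · by_cases h2 : a = u ∧ b = v
        · obtain ⟨rfl, rfl⟩ := h2
          simp [this]
        · simp [h1, h2]
    · exact hJ.acyclic.sup_edge_of_not_reachable fun h => hne ((hJ.eq_iff u v).mpr h)
    · refine sup_le hJ.le ?_
      intro a b hab
      rw [SimpleGraph.edge_adj] at hab
      rcases hab.1 with ⟨rfl, rfl⟩ | ⟨rfl, rfl⟩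
      · exact huv
      · exact huv.symm
    · intro z
      by_cases h : L z = L u
      · simp [h, hJ.idem, Ne.symm hne]
      · simp [h, hJ.idem]
    · intro a b hab
      simp only [hJ.lab, Fin.val_inj] at hab
      rw [hlab, hlab, hab]
    · rw [hlab, hlab]
      simp

/-- The number of elements below `j` of a set of vertices grows by one when `j` is in the set. -/
theorem card_filter_lt_succ {n : ℕ} (p : Fin n → Prop) [DecidablePred p] (w : Fin n) :
    (Finset.univ.filter fun z : Fin n => (z : ℕ) < w + 1 ∧ p z).card =
      (Finset.univ.filter fun z : Fin n => (z : ℕ) < w ∧ p z).card + if p w then 1 else 0 := by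
  by_cases hp : p w
  · have : (Finset.univ.filter fun z : Fin n => (z : ℕ) < w + 1 ∧ p z) =
        insert w (Finset.univ.filter fun z : Fin n => (z : ℕ) < w ∧ p z) := by
      ext z
      simp only [Finset.mem_filter, Finset.mem_univ, true_and, Finset.mem_insert, Fin.ext_iff]
      constructor
      · rintro ⟨h1, h2⟩
        by_cases h : (z : ℕ) = w
        · exact .inl h
        · exact .inr ⟨by omega, h2⟩
      · rintro (h | ⟨h1, h2⟩)
        · exact ⟨by omega, (Fin.ext h : z = w) ▸ hp⟩
        · exact ⟨by omega, h2⟩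
    rw [this, Finset.card_insert_of_notMem (by simp), if_pos hp]
  · simp only [if_neg hp, add_zero]
    refine congrArg Finset.card ?_
    ext z
    simp only [Finset.mem_filter, Finset.mem_univ, true_and]
    constructor
    · rintro ⟨h1, h2⟩
      have : (z : ℕ) ≠ w := fun h => hp ((Fin.ext h : z = w) ▸ h2)
      exact ⟨by omega, h2⟩
    · rintro ⟨h1, h2⟩
      exact ⟨by omega, h2⟩

/-- Computes a spanning forest of the subgraph induced by `U`, labels of its components, and their
number `x_k`. -/
def label : Prog :=
  forTo x_u x_n (a_lab⟪x_u⟫ ≔ x_u ;; forTo x_v x_n (a_tree⟪a_row⟪x_u⟫ + x_v⟫ ≔ .const 0)) ;;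
  forTo x_u x_n (forTo x_v x_n (.cond a_adj⟪a_row⟪x_u⟫ + x_v⟫
    (.cond a_set⟪x_u⟫ (.cond a_set⟪x_v⟫ joinTrees .skip) .skip) .skip)) ;;
  x_k ≔ .const 0 ;;
  forTo x_u x_n (.cond a_set⟪x_u⟫
    (.cond (Exp.ne a_lab⟪x_u⟫ x_u) .skip (x_k ≔ (x_k + .const 1))) .skip)

/-- The state after `label`. -/
def Labelled {n : ℕ} (G : SimpleGraph (Fin n)) (U : Finset (Fin n)) (σ : State) : Prop :=
  ∃ H L, Forest G U H L σ ∧ IsLabel G U L ∧ σ.var x_k = numComp G U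

theorem wp_label_start {y n : ℕ} {G : SimpleGraph (Fin n)} {U : Finset (Fin n)} {σ : State}
    (hny : n ≤ y) (hC : Ctx G σ) :
    (forTo x_u x_n (a_lab⟪x_u⟫ ≔ x_u ;;
      forTo x_v x_n (a_tree⟪a_row⟪x_u⟫ + x_v⟫ ≔ .const 0))).wp y
      (fun τ => ∃ H L, Forest G U H L τ) σ := by
  classical
  refine wp_forTo (fun j ρ => ∀ a : Fin n, (a : ℕ) < j → ρ.arr a_lab a = a ∧
      ∀ b : Fin n, ρ.arr a_tree (a * n + b) = 0) (m := n) hC.num hny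
    (by decide) rfl rfl (fun _ _ _ h => h) (fun a h => absurd h (Nat.not_lt_zero _)) ?_ ?_
  · intro j ρ hj hF hu hI
    obtain ⟨w, rfl⟩ : ∃ w : Fin n, (w : ℕ) = j := ⟨⟨j, hj⟩, rfl⟩
    simp only [wp_seq, wp_write, Exp.val_var, hu]
    refine wp_forTo (fun j ρ' => (∀ a : Fin n, (a : ℕ) < w → ∀ b : Fin n,
        ρ'.arr a_tree (a * n + b) = 0) ∧ ∀ b : Fin n, (b : ℕ) < j →
        ρ'.arr a_tree (w * n + b) = 0) (m := n)
      (by simpa [hF.var x_n rfl] using hC.num) hny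
      (by decide) rfl rfl (fun _ _ _ h => h) ?_ ?_ ?_
    · exact ⟨fun a ha b => by simpa using (hI a ha).2 b, fun b h => absurd h (Nat.not_lt_zero _)⟩
    · rintro j ρ' hj hF' hv ⟨h1, h2⟩
      have hrow : ρ'.arr a_row w = w * n := by
        rw [hF'.arr a_row rfl]
        simpa [hF.arr a_row rfl] using hC.row w
      have hu' : ρ'.var x_u = w := by rw [hF'.var x_u rfl]; simpa using hu
      simp only [wp_write, Exp.val_add, Exp.val_read, Exp.val_var, Exp.val_const, hv, hu', hrow,
        State.setArr_arr, true_and]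
      refine ⟨fun a ha b => ?_, fun b hb => ?_⟩
      · rw [h1 a ha b, ite_self]
      · split_ifs with h
        · rfl
        · exact h2 b (by omega)
    · rintro ρ' hF' ⟨h1, h2⟩ a ha
      rw [hF'.arr a_lab rfl]
      rcases Nat.lt_succ_iff_lt_or_eq.mp ha with h | h
      · refine ⟨?_, h1 a h⟩
        simp only [State.setArr_arr, true_and]
        rw [if_neg (by omega), (hI a h).1]
      · obtain rfl : a = w := Fin.ext h
        exact ⟨by simp, fun b => h2 b b.isLt⟩
  · intro ρ hF hI
    exact ⟨⊥, id, fun v => (hI v v.isLt).1, fun u v => by simpa using (hI u u.isLt).2 v,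
      SimpleGraph.isAcyclic_bot, bot_le, by simp, fun _ => rfl⟩

theorem wp_label {y n : ℕ} {G : SimpleGraph (Fin n)} {U : Finset (Fin n)} {σ : State}
    (hny : n ≤ y) (hC : Ctx G σ) (hU : HasSet U σ) : label.wp y (Labelled G U) σ := by
  classical
  unfold label
  refine wp_seq_of (wp_label_start (U := U) hny hC) fun σ₁ hF₁ hJ₁ => ?_
  have hC₁ : Ctx G σ₁ := hC.frame hF₁ rfl rfl rfl rfl
  have hU₁ : HasSet U σ₁ := hU.frame hF₁ rfl
  have hcoarse : ∀ ρ τ υ, CoarserLabels n ρ τ → CoarserLabels n τ υ → CoarserLabels n ρ υ :=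
    fun _ _ _ h h' a b hab => h' a b (h a b hab)
  refine wp_seq_of (R := fun τ => (∃ H L, Forest G U H L τ) ∧
    ∀ u v : Fin n, (inside G U).Adj u v → τ.arr a_lab u = τ.arr a_lab v) ?_ ?_
  · refine wp_forTo_forall (fun ρ => ∃ H L, Forest G U H L ρ) (CoarserLabels n)
      (fun j ρ => ∀ u v : Fin n, (u : ℕ) = j → (inside G U).Adj u v →
        ρ.arr a_lab u = ρ.arr a_lab v) hC₁.num hny (by decide) rfl rfl
      (fun _ _ _ h => h) hcoarse (fun j ρ τ h h' u v hu huv => h u v (h' u v hu huv))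
      (fun ρ k ⟨H, L, h⟩ => ⟨H, L, h.lab, h.tree, h.acyclic, h.le, h.eq_iff, h.idem⟩)
      (fun ρ k a b h => h) hJ₁ ?_ ?_
    · intro j ρ hj hF hu hJ _
      obtain ⟨u, rfl⟩ : ∃ w : Fin n, (w : ℕ) = j := ⟨⟨j, hj⟩, rfl⟩
      refine wp_forTo_forall (fun ρ => ∃ H L, Forest G U H L ρ) (CoarserLabels n)
        (fun j ρ => ∀ v : Fin n, (v : ℕ) = j → (inside G U).Adj u v →
          ρ.arr a_lab u = ρ.arr a_lab v) (m := n) ((hF.var x_n rfl).trans hC₁.num) hny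
        (by decide) rfl rfl
        (fun _ _ _ h => h) hcoarse (fun j ρ τ h h' v hv huv => h u v (h' v hv huv))
        (fun ρ k ⟨H, L, h⟩ => ⟨H, L, h.lab, h.tree, h.acyclic, h.le, h.eq_iff, h.idem⟩)
        (fun ρ k a b h => h) hJ ?_ ?_
      · intro j ρ' hj hF' hv hJ' _
        obtain ⟨v, rfl⟩ : ∃ w : Fin n, (w : ℕ) = j := ⟨⟨j, hj⟩, rfl⟩
        have hu' : ρ'.var x_u = u := (hF'.var x_u rfl).trans hu
        have hC' : Ctx G ρ' := (hC₁.frame hF rfl rfl rfl rfl).frame hF' rfl rfl rfl rfl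
        have hU' : HasSet U ρ' := (hU₁.frame hF rfl).frame hF' rfl
        have hskip : ¬ (inside G U).Adj u v → (∃ H L, Forest G U H L ρ') ∧
            CoarserLabels n ρ' ρ' ∧ ∀ v' : Fin n, (v' : ℕ) = v → (inside G U).Adj u v' →
            ρ'.arr a_lab u = ρ'.arr a_lab v' := fun h => ⟨hJ', fun _ _ h => h, fun v' hv' huv => by
          rw [Fin.ext hv'] at huv
          exact absurd huv h⟩
        simp only [wp_cond, wp_skip, Exp.val_read, Exp.val_add, Exp.val_var, hu', hv, hC'.row,
          hC'.adj, hU' u, hU' v, ne_eq, ite_eq_right_iff, one_ne_zero, imp_false, not_not]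
        refine ⟨fun h1 => ⟨fun h2 => ⟨fun h3 => ?_, fun h3 => hskip fun h => h3 h.2.2⟩,
          fun h2 => hskip fun h => h2 h.2.1⟩, fun h1 => hskip fun h => h1 h.1⟩
        refine Prog.wp_mono (wp_joinTrees hny hC' hJ' hu' hv ⟨h1, h2, h3⟩) ?_
        rintro τ ⟨g1, g2, g3⟩
        exact ⟨g1, g2, fun v' hv' _ => by rw [Fin.ext hv']; exact g3⟩
      · intro ρ' hF' hJ' hR hall
        exact ⟨hJ', hR, fun u' v hu' huv => by
          obtain rfl := Fin.ext hu'
          exact hall v v.isLt v rfl huv⟩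
    · intro ρ hF hJ _ hall
      exact ⟨hJ, fun u v huv => hall u u.isLt u v rfl huv⟩
  · rintro σ₂ hF₂ ⟨⟨H, L, hJ⟩, hall⟩
    have hC₂ : Ctx G σ₂ := hC₁.frame hF₂ rfl rfl rfl rfl
    have hU₂ : HasSet U σ₂ := hU₁.frame hF₂ rfl
    have hL : IsLabel G U L := by
      refine ⟨fun u v => ⟨fun h => ((hJ.eq_iff u v).mp h).mono hJ.le, fun h => ?_⟩, hJ.idem⟩
      rw [SimpleGraph.reachable_iff_reflTransGen] at h
      induction h with
      | refl => rfl
      | tail _ hab ih =>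
        have := hall _ _ hab
        rw [hJ.lab, hJ.lab] at this
        exact ih.trans (Fin.ext this)
    rw [wp_seq, wp_assign, Exp.val_const]
    refine wp_forTo (fun j ρ => ρ.var x_k = (Finset.univ.filter fun z : Fin n =>
        (z : ℕ) < j ∧ (z ∈ U ∧ L z = z)).card) (m := n) (by simpa using hC₂.num) hny
      (by decide) rfl rfl (fun _ _ _ h => by simpa using h) (by simp) ?_ ?_
    · intro j ρ hj hF hu hI
      obtain ⟨w, rfl⟩ : ∃ w : Fin n, (w : ℕ) = j := ⟨⟨j, hj⟩, rfl⟩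
      have hset : ρ.arr a_set w = if w ∈ U then 1 else 0 := by
        rw [hF.arr a_set rfl]; exact hU₂ w
      have hlab : ρ.arr a_lab w = L w := by rw [hF.arr a_lab rfl]; exact hJ.lab w
      simp only [wp_cond, wp_skip, wp_assign, Exp.val_read, Exp.val_add, Exp.val_var,
        Exp.val_const, hu, hset, hlab, hI, Exp.val_ne_eq_zero, State.setVar_var, if_true, ne_eq,
        ite_eq_right_iff, one_ne_zero, imp_false, not_not, card_filter_lt_succ, Fin.val_inj]
      refine ⟨fun h1 => ⟨fun h2 => by simp [h2], fun h2 => by simp [h1, h2]⟩,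
        fun h1 => by simp [h1]⟩
    · intro ρ hF hI
      refine ⟨H, L, ⟨?_, ?_, hJ.acyclic, hJ.le, hJ.eq_iff, hJ.idem⟩, hL, ?_⟩
      · rw [hF.arr a_lab rfl]; exact hJ.lab
      · rw [hF.arr a_tree rfl]; exact hJ.tree
      · rw [hI, hL.numComp_eq, hL.image_eq_filter]
        congr 1
        ext z
        simp

/-! ### Adding vertices that see many components -/

/-- Computes in `x_cnt` the number of components that the vertex `x_w` sees. -/
def countSeen : Prog :=
  x_cnt ≔ .const 0 ;;
  forTo x_z x_n (x_hit ≔ .const 0 ;;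
    forTo x_u x_n (.cond a_adj⟪a_row⟪x_w⟫ + x_u⟫
      (.cond a_set⟪x_u⟫ (.cond (Exp.ne a_lab⟪x_u⟫ x_z) .skip (x_hit ≔ .const 1)) .skip) .skip) ;;
    x_cnt ≔ (x_cnt + x_hit))

/-- Looks for a vertex `x_cand` that sees more than `x_t` components. -/
def search : Prog :=
  forTo x_w x_n (countSeen ;;
    .cond (x_cnt - x_t) (x_cand ≔ x_w ;; x_flag ≔ .const 1) .skip)

/-- Adds vertices to `U` as long as one of them sees more than `x_t` components. -/
def grow : Prog :=
  x_flag ≔ .const 1 ;;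
  .loop x_flag (x_flag ≔ .const 0 ;; label ;; search ;;
    .cond x_flag (a_set⟪x_cand⟫ ≔ .const 1) .skip)

theorem wp_countSeen {y n : ℕ} {G : SimpleGraph (Fin n)} {U : Finset (Fin n)}
    {H : SimpleGraph (Fin n)} {L : Fin n → Fin n} {σ : State} (hny : n ≤ y) (hC : Ctx G σ)
    (hU : HasSet U σ) (hJ : Forest G U H L σ) {w : Fin n} (hw : σ.var x_w = w) :
    countSeen.wp y (fun τ => τ.var x_cnt = (seen G U L w).card) σ := by
  classical
  unfold countSeen
  rw [wp_seq, wp_assign, Exp.val_const]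
  refine wp_forTo (fun j ρ => ρ.var x_cnt = (Finset.univ.filter fun z : Fin n =>
      (z : ℕ) < j ∧ z ∈ seen G U L w).card) (m := n) (by simpa using hC.num) hny
    (by decide) rfl rfl (fun _ _ _ h => by simpa using h) (by simp) ?_ ?_
  · intro j ρ hj hF hz hI
    obtain ⟨z, rfl⟩ : ∃ z : Fin n, (z : ℕ) = j := ⟨⟨j, hj⟩, rfl⟩
    rw [wp_seq, wp_assign, Exp.val_const]
    refine wp_seq_of (R := fun τ => τ.var x_hit = if z ∈ seen G U L w then 1 else 0) ?_ ?_
    · refine wp_forTo (fun j ρ' => ρ'.var x_hit =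
          if ∃ u : Fin n, (u : ℕ) < j ∧ u ∈ U ∧ G.Adj w u ∧ L u = z then 1 else 0) (m := n)
        (by simpa [hF.var x_n rfl] using hC.num) hny (by decide) rfl rfl
        (fun _ _ _ h => by simpa using h) (by simp) ?_ ?_
      · intro j ρ' hj hF' hu hI'
        obtain ⟨u, rfl⟩ : ∃ u : Fin n, (u : ℕ) = j := ⟨⟨j, hj⟩, rfl⟩
        have hvar : ∀ x, x ≠ x_hit → x ≠ x_u → x ≠ x_cnt → x ≠ x_z → ρ'.var x = σ.var x := by
          intro x h1 h2 h3 h4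
          rw [hF'.var x (by simp [forTo, Prog.modVar, h1, h2]), State.setVar_var, if_neg h1,
            hF.var x (by simp [forTo, Prog.modVar, h1, h2, h3, h4]), State.setVar_var, if_neg h3]
        have harr : ∀ a, ρ'.arr a = σ.arr a := by
          intro a
          rw [hF'.arr a rfl, State.setVar_arr, hF.arr a rfl, State.setVar_arr]
        have hw' : ρ'.var x_w = w := (hvar x_w (by decide) (by decide) (by decide)
          (by decide)).trans hw
        have hz' : ρ'.var x_z = z := by
          rw [hF'.var x_z rfl]; simpa using hz
        simp only [wp_cond, wp_skip, wp_assign, Exp.val_read, Exp.val_add, Exp.val_var,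
          Exp.val_const, harr, hw', hz', hu, hC.row, hC.adj, hU u, hJ.lab, Exp.val_ne_eq_zero,
          State.setVar_var, if_true, ne_eq, ite_eq_right_iff, one_ne_zero, imp_false, not_not,
          hI', Fin.val_inj]
        have hno : ¬ (G.Adj w u ∧ u ∈ U ∧ L u = z) →
            (if ∃ v : Fin n, (v : ℕ) < u ∧ v ∈ U ∧ G.Adj w v ∧ L v = z then 1 else 0) =
            (if ∃ v : Fin n, (v : ℕ) < u + 1 ∧ v ∈ U ∧ G.Adj w v ∧ L v = z then 1 else 0) := by
          intro h
          refine if_congr ⟨fun ⟨v, h1, h2⟩ => ⟨v, by omega, h2⟩, fun ⟨v, h1, h2⟩ => ?_⟩ rfl rfl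
          refine ⟨v, lt_of_le_of_ne (Nat.lt_succ_iff.mp h1) fun e => h ?_, h2⟩
          rw [← (Fin.ext e : v = u)]
          exact ⟨h2.2.1, h2.1, h2.2.2⟩
        refine ⟨fun h1 => ⟨fun h2 => ⟨fun h3 => hno fun h => h3 h.2.2, fun h3 => ?_⟩,
          fun h2 => hno fun h => h2 h.2.1⟩, fun h1 => hno fun h => h1 h.1⟩
        rw [if_pos ⟨u, by omega, h2, h1, h3⟩]
      · intro ρ' hF' hI'
        rw [hI']
        refine if_congr ?_ rfl rfl
        rw [mem_seen]
        exact exists_congr fun u => by simp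
    · intro τ hF' hhit
      have hcnt : τ.var x_cnt = ρ.var x_cnt := by rw [hF'.var x_cnt rfl]; simp
      simp only [wp_assign, Exp.val_add, Exp.val_var, State.setVar_var, if_true, hcnt, hI, hhit,
        card_filter_lt_succ]
  · intro ρ hF hI
    rw [hI]
    congr 1
    ext z
    simp

theorem wp_search {y n t : ℕ} {G : SimpleGraph (Fin n)} {U : Finset (Fin n)}
    {H : SimpleGraph (Fin n)} {L : Fin n → Fin n} {σ : State} (hny : n ≤ y) (hC : Ctx G σ)
    (hU : HasSet U σ) (hJ : Forest G U H L σ) (ht : σ.var x_t = t) (hflag : σ.var x_flag = 0) :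
    search.wp y (fun τ => (τ.var x_flag = 0 ∧ ∀ w, (seen G U L w).card ≤ t) ∨
      (τ.var x_flag = 1 ∧ ∃ w : Fin n, τ.var x_cand = w ∧ t < (seen G U L w).card)) σ := by
  unfold search
  refine wp_forTo (fun j ρ =>
      (ρ.var x_flag = 0 ∧ ∀ w : Fin n, (w : ℕ) < j → (seen G U L w).card ≤ t) ∨
      (ρ.var x_flag = 1 ∧ ∃ w : Fin n, ρ.var x_cand = w ∧ t < (seen G U L w).card)) (m := n)
    hC.num hny (by decide) rfl rfl (fun _ _ _ h => by simpa using h)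
    (.inl ⟨hflag, fun w h => absurd h (Nat.not_lt_zero _)⟩) ?_ ?_
  · intro j ρ hj hF hw hI
    obtain ⟨w, rfl⟩ : ∃ w : Fin n, (w : ℕ) = j := ⟨⟨j, hj⟩, rfl⟩
    refine wp_seq_of (wp_countSeen hny (hC.frame hF rfl rfl rfl rfl) (hU.frame hF rfl)
      (hJ.frame hF rfl rfl) hw) fun τ hF' hcnt => ?_
    have ht' : τ.var x_t = t := by rw [hF'.var x_t rfl, hF.var x_t rfl, ht]
    have hw' : τ.var x_w = w := by rw [hF'.var x_w rfl, hw]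
    have hfl : τ.var x_flag = ρ.var x_flag := hF'.var x_flag rfl
    have hca : τ.var x_cand = ρ.var x_cand := hF'.var x_cand rfl
    simp only [wp_cond, wp_seq, wp_assign, wp_skip, Exp.val_sub, Exp.val_var, Exp.val_const, hcnt,
      ht', hw', State.setVar_var]
    refine ⟨fun h => .inr ⟨by simp, w, by simp, by omega⟩, fun h => ?_⟩
    rw [hfl, hca]
    rcases hI with ⟨h1, h2⟩ | hI
    · refine .inl ⟨h1, fun w' hw' => ?_⟩
      rcases Nat.lt_succ_iff_lt_or_eq.mp hw' with h' | h'
      · exact h2 w' h'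
      · rw [Fin.ext h']; omega
    · exact .inr hI
  · intro ρ hF hI
    rcases hI with ⟨h1, h2⟩ | hI
    · exact .inl ⟨h1, fun w => h2 w w.isLt⟩
    · exact .inr hI

/-- The invariant while vertices are added that see more than `t` components: each of them reduces
the number of components by at least `t`. -/
structure GrowInv {n : ℕ} (G : SimpleGraph (Fin n)) (S : Finset (Fin n)) (t : ℕ)
    (U : Finset (Fin n)) : Prop where
  subset : S ⊆ U
  anchored : Anchored G S U
  card_le : U.card * t + numComp G U ≤ S.card * t + S.card

theorem GrowInv.start {n : ℕ} (G : SimpleGraph (Fin n)) (S : Finset (Fin n)) (t : ℕ) :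
    GrowInv G S t S where
  subset := subset_rfl
  anchored u hu := ⟨u, hu, .rfl⟩
  card_le := Nat.add_le_add_left (numComp_le_card S fun x hx => ⟨x, hx, .rfl⟩) _

theorem HasSet.insert {n : ℕ} {U : Finset (Fin n)} {σ : State} (h : HasSet U σ) (w : Fin n) :
    HasSet (insert w U) (σ.setArr a_set w 1) := by
  intro v
  by_cases hv : v = w
  · subst hv; simp
  · have : (v : ℕ) ≠ w := fun e => hv (Fin.ext e)
    simp [this, h v, hv]

theorem wp_grow {y n t : ℕ} {G : SimpleGraph (Fin n)} {S : Finset (Fin n)} {σ : State}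
    (hny : n ≤ y) (hC : Ctx G σ) (hU : HasSet S σ) (hS : S.Nonempty) (ht : σ.var x_t = t)
    (ht1 : 1 ≤ t) :
    grow.wp y (fun τ => ∃ U H L, HasSet U τ ∧ GrowInv G S t U ∧ Forest G U H L τ ∧
      IsLabel G U L ∧ τ.var x_k = numComp G U ∧ ∀ w, (seen G U L w).card ≤ t) σ := by
  unfold grow
  rw [wp_seq, wp_assign, Exp.val_const]
  have hle : ∀ U : Finset (Fin n), numComp G U ≤ n := fun U =>
    (numComp_le_card U fun x hx => ⟨x, hx, .rfl⟩).trans ((Finset.card_le_univ U).trans (by simp))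
  refine Prog.wp_loop (fun k ρ => ∃ U, HasSet U ρ ∧ GrowInv G S t U ∧
      ((ρ.var x_flag = 1 ∧ numComp G U ≤ k) ∨ (ρ.var x_flag = 0 ∧ ∃ H L, Forest G U H L ρ ∧
        IsLabel G U L ∧ ρ.var x_k = numComp G U ∧ ∀ w, (seen G U L w).card ≤ t)))
    (k := n) hny ?_ ?_ ?_
  · exact ⟨S, fun v => by simpa using hU v, .start G S t, .inl ⟨by simp, hle S⟩⟩
  · rintro k ρ hF ⟨U, hU, hI, hcase⟩ he
    have hk : numComp G U ≤ k := by
      rcases hcase with h | h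
      · exact h.2
      · exact absurd h.1 he
    have hk1 : 1 ≤ numComp G U := one_le_numComp (hS.mono hI.subset)
    refine ⟨k - 1, by omega, ?_⟩
    have hC' : Ctx G ρ := Ctx.frame (σ := σ.setVar x_flag 1)
      ⟨by simpa using hC.num, hC.row, hC.pow, hC.adj⟩ hF rfl rfl rfl rfl
    have ht' : ρ.var x_t = t := by rw [hF.var x_t rfl]; simpa using ht
    rw [wp_seq, wp_assign, Exp.val_const]
    have hC'' : Ctx G (ρ.setVar x_flag 0) := ⟨by simpa using hC'.num, hC'.row, hC'.pow, hC'.adj⟩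
    refine wp_seq_of (wp_label (U := U) hny hC'' hU) ?_
    rintro τ hF₁ ⟨H, L, hJ, hL, hx⟩
    have hU₁ : HasSet U τ := HasSet.frame (σ := ρ.setVar x_flag 0) hU hF₁ rfl
    have ht₁ : τ.var x_t = t := by rw [hF₁.var x_t rfl]; simpa using ht'
    refine wp_seq_of (wp_search hny (hC''.frame hF₁ rfl rfl rfl rfl) hU₁ hJ ht₁
      (by rw [hF₁.var x_flag rfl]; simp)) ?_
    rintro υ hF₂ hres
    have hU₂ : HasSet U υ := hU₁.frame hF₂ rfl
    simp only [wp_cond, wp_write, wp_skip, Exp.val_var, Exp.val_const]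
    rcases hres with ⟨h1, h2⟩ | ⟨h1, w, hw, h2⟩
    · refine ⟨fun h => absurd h1 h, fun _ => ⟨U, hU₂, hI, .inr ⟨h1, H, L, hJ.frame hF₂ rfl rfl, hL,
        ?_, h2⟩⟩⟩
      rw [hF₂.var x_k rfl, hx]
    · refine ⟨fun _ => ⟨insert w U, ?_, ?_, .inl ⟨by simpa using h1, ?_⟩⟩, fun h => by omega⟩
      · rw [hw]
        exact hU₂.insert w
      · refine ⟨hI.subset.trans (Finset.subset_insert _ _),
          hI.anchored.insert hL (Finset.card_pos.mp (by omega)), ?_⟩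
        have h3 := numComp_insert_add_card_seen_le hL w
        have h4 := Nat.mul_le_mul_right t (Finset.card_insert_le w U)
        have h5 := hI.card_le
        rw [Nat.succ_mul] at h4
        omega
      · have h3 := numComp_insert_add_card_seen_le hL w
        omega
  · rintro k ρ hF ⟨U, hU, hI, hcase⟩ he
    rcases hcase with h | h
    · exact absurd he (by simp [h.1])
    · obtain ⟨_, H, L, h1, h2, h3, h4⟩ := h
      exact ⟨U, H, L, hU, hI, h1, h2, h3, h4⟩

/-! ### Joining components optimally -/

/-- Assigns distinct powers of two to at most `x_g + 1` of the representatives of components. -/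
def select : Prog :=
  x_pw ≔ .const 1 ;; x_cnt ≔ .const 0 ;;
  forTo x_v x_n (a_bit⟪x_v⟫ ≔ .const 0 ;;
    .cond a_set⟪x_v⟫ (.cond (Exp.ne a_lab⟪x_v⟫ x_v) .skip
      (.cond ((x_g + .const 1) - x_cnt)
        (a_bit⟪x_v⟫ ≔ x_pw ;; x_pw ≔ (x_pw + x_pw) ;; x_cnt ≔ (x_cnt + .const 1) ;;
          x_root ≔ x_v)
        .skip)) .skip)

theorem wp_select {y n g : ℕ} {G : SimpleGraph (Fin n)} {U : Finset (Fin n)}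
    {H : SimpleGraph (Fin n)} {L : Fin n → Fin n} {σ : State} (hny : n ≤ y) (hC : Ctx G σ)
    (hU : HasSet U σ) (hJ : Forest G U H L σ) (hL : IsLabel G U L) (hg : σ.var x_g = g) :
    select.wp y (fun τ => ∃ A b κ, IsBits b A κ ∧ A ⊆ U.image L ∧
      (∀ v : Fin n, τ.arr a_bit v = b v) ∧ τ.var x_pw = 2 ^ κ ∧ κ = min (numComp G U) (g + 1) ∧
      (A.Nonempty → ∃ v ∈ A, τ.var x_root = v)) σ := by
  classical
  rw [select, wp_seq, wp_assign, wp_seq, wp_assign, Exp.val_const, Exp.val_const]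
  refine wp_forTo (fun j ρ => ∃ A b κ, IsBits b A κ ∧ A ⊆ U.image L ∧ (∀ v ∈ A, (v : ℕ) < j) ∧
      (∀ v : Fin n, (v : ℕ) < j → ρ.arr a_bit v = b v) ∧ ρ.var x_pw = 2 ^ κ ∧ ρ.var x_cnt = κ ∧
      κ = min (Finset.univ.filter fun z : Fin n => (z : ℕ) < j ∧ (z ∈ U ∧ L z = z)).card (g + 1) ∧
      (A.Nonempty → ∃ v ∈ A, ρ.var x_root = v)) (m := n) (by simpa using hC.num) hny
    (by decide) rfl rfl ?_ ?_ ?_ ?_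
  · rintro j ρ k ⟨A, b, κ, h1, h2, h3, h4, h5, h6, h7, h8⟩
    exact ⟨A, b, κ, h1, h2, h3, h4, by simpa using h5, by simpa using h6, h7, by simpa using h8⟩
  · exact ⟨∅, fun _ => 0, 0, ⟨by simp, by simp, by simp, by simp, rfl⟩, by simp, by simp, by simp,
      by simp, by simp, by simp, by simp⟩
  · rintro j ρ hj hF hv ⟨A, b, κ, h1, h2, h3, h4, h5, h6, h7, h8⟩
    obtain ⟨w, rfl⟩ : ∃ z : Fin n, (z : ℕ) = j := ⟨⟨j, hj⟩, rfl⟩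
    have hset : ρ.arr a_set w = if w ∈ U then 1 else 0 := by
      rw [hF.arr a_set rfl]; exact hU w
    have hlab : ρ.arr a_lab w = L w := by rw [hF.arr a_lab rfl]; exact hJ.lab w
    have hg' : ρ.var x_g = g := by rw [hF.var x_g rfl]; simpa using hg
    have hwA : w ∉ A := fun h => absurd (h3 w h) (lt_irrefl _)
    have hbit : ∀ (k : ℕ) (v : Fin n), (v : ℕ) < w + 1 →
        (if v = w then k else ρ.arr a_bit v) = Function.update b w k v := by
      intro k v hvw
      by_cases h : v = w
      · rw [if_pos h, h, Function.update_self]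
      · have h' : (v : ℕ) ≠ w := fun e => h (Fin.ext e)
        rw [if_neg h, Function.update_of_ne h, h4 v (by omega)]
    have hb0 : Function.update b w 0 = b := by rw [← h1.zero w hwA, Function.update_eq_self]
    -- When no number is assigned to `w`, the choice made so far stays valid.
    have hskip : (¬ (w ∈ U ∧ L w = w) ∨ g + 1 ≤ κ) →
        ∃ A b κ', IsBits b A κ' ∧ A ⊆ U.image L ∧ (∀ v ∈ A, (v : ℕ) < w + 1) ∧
        (∀ v : Fin n, (v : ℕ) < w + 1 → (if v = w then 0 else ρ.arr a_bit v) = b v) ∧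
        2 ^ κ = 2 ^ κ' ∧ κ = κ' ∧
        κ' = min ((Finset.univ.filter fun z : Fin n => (z : ℕ) < w + 1 ∧
          (z ∈ U ∧ L z = z)).card) (g + 1) ∧ (A.Nonempty → ∃ v ∈ A, ρ.var x_root = v) := by
      intro h
      refine ⟨A, b, κ, h1, h2, fun v hv => by have := h3 v hv; omega, ?_, rfl, rfl, ?_, h8⟩
      · intro v hv
        rw [hbit 0 v hv, hb0]
      · rw [card_filter_lt_succ]
        rcases h with h | h
        · rw [if_neg h]; exact h7
        · omega
    simp only [wp_seq, wp_cond, wp_write, wp_assign, wp_skip, Exp.val_read, Exp.val_add,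
      Exp.val_sub, Exp.val_var, Exp.val_const, Exp.val_ne_eq_zero, hv, State.setArr_arr,
      State.setArr_var, State.setVar_var, State.setVar_arr, hg', h5, h6, hset, hlab,
      Nat.reduceEqDiff, and_true, true_and, if_true, if_false, Fin.val_inj, ne_eq,
      ite_eq_right_iff, one_ne_zero, imp_false, not_not]
    refine ⟨fun g1 => ⟨fun g2 => ?_, fun g2 => ⟨fun g3 => ?_, fun g3 => ?_⟩⟩, fun g1 => ?_⟩
    · exact hskip (.inl fun h => g2 h.2)
    · clear hskip
      refine ⟨insert w A, Function.update b w (2 ^ κ), κ + 1, h1.insert hwA, ?_, ?_, ?_,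
        by rw [pow_succ]; omega, rfl, ?_, fun _ => ⟨w, Finset.mem_insert_self _ _, rfl⟩⟩
      · refine Finset.insert_subset (Finset.mem_image.mpr ⟨w, g1, g2⟩) h2
      · intro v hv
        rcases Finset.mem_insert.mp hv with rfl | hv
        · omega
        · have := h3 v hv; omega
      · intro v hv
        rw [← hbit (2 ^ κ) v hv]
        split_ifs <;> rfl
      · rw [card_filter_lt_succ, if_pos ⟨g1, g2⟩]
        omega
    · exact hskip (.inr (by clear hskip; omega))
    · exact hskip (.inl fun h => g1 h.1)
  · rintro ρ hF ⟨A, b, κ, h1, h2, h3, h4, h5, h6, h7, h8⟩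
    refine ⟨A, b, κ, h1, h2, fun v => h4 v v.isLt, h5, ?_, h8⟩
    rw [h7, hL.numComp_eq, hL.image_eq_filter]
    congr 2
    ext z
    simp

/-- The state holds, in addition to the graph, the set `U`, the numbers `b v` and the offsets of
the rows of the tables. -/
structure TableCtx {n : ℕ} (G : SimpleGraph (Fin n)) (U : Finset (Fin n)) (b : Fin n → ℕ) (κ : ℕ)
    (σ : State) : Prop where
  ctx : Ctx G σ
  set : HasSet U σ
  bit : ∀ v : Fin n, σ.arr a_bit v = b v
  size : σ.var x_pw = 2 ^ κ
  off : ∀ v : Fin n, σ.arr a_off v = v * 2 ^ κ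

theorem TableCtx.frame {n κ : ℕ} {G : SimpleGraph (Fin n)} {U : Finset (Fin n)} {b : Fin n → ℕ}
    {P : Prog} {σ τ : State} (h : TableCtx G U b κ σ) (hF : Frame P σ τ)
    (h0 : P.modVar x_n = false) (h1 : P.modVar x_pw = false)
    (h2 : ∀ a ∈ [a_row, a_pow, a_adj, a_set, a_bit, a_off], P.modArr a = false) :
    TableCtx G U b κ τ where
  ctx := h.ctx.frame hF h0 (h2 _ (by simp)) (h2 _ (by simp)) (h2 _ (by simp))
  set := h.set.frame hF (h2 _ (by simp))
  bit v := by rw [hF.arr _ (h2 a_bit (by simp))]; exact h.bit v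
  size := (hF.var _ h1).trans h.size
  off v := by rw [hF.arr _ (h2 a_off (by simp))]; exact h.off v

/-- The tables for the dynamic program: every entry is sound, and the set `{v}` has cost zero. -/
structure Table {n : ℕ} (G : SimpleGraph (Fin n)) (U : Finset (Fin n)) (b : Fin n → ℕ) (κ : ℕ)
    (σ : State) : Prop where
  entry : ∀ v : Fin n, ∀ X < 2 ^ κ,
    Entry G U b (σ.arr a_fam (v * 2 ^ κ + X)) (σ.arr a_cost (v * 2 ^ κ + X)) v X
  single : ∀ v : Fin n, σ.arr a_cost (v * 2 ^ κ + b v) = 0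

/-- Fills the tables: the set for the root `v` and the terminals encoded by `X` is `{v}` if these
are the terminals in `{v}`, and otherwise it is the set of all vertices. -/
def startTables : Prog :=
  fillMultiples a_off x_pw ;;
  forTo x_v x_n (
    forTo x_X x_pw (a_fam⟪a_off⟪x_v⟫ + x_X⟫ ≔ (a_pow⟪x_n⟫ - .const 1) ;;
      a_cost⟪a_off⟪x_v⟫ + x_X⟫ ≔ x_n) ;;
    a_fam⟪a_off⟪x_v⟫ + a_bit⟪x_v⟫⟫ ≔ a_pow⟪x_v⟫ ;;
    a_cost⟪a_off⟪x_v⟫ + a_bit⟪x_v⟫⟫ ≔ .const 0)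

theorem wp_startTables {y n κ : ℕ} {G : SimpleGraph (Fin n)} {U A : Finset (Fin n)}
    {b : Fin n → ℕ} {σ : State} (hny : n ≤ y) (hκy : 2 ^ κ ≤ y) (hG : G.Connected)
    (hb : IsBits b A κ) (hC : Ctx G σ) (hU : HasSet U σ)
    (hbit : ∀ v : Fin n, σ.arr a_bit v = b v) (hpw : σ.var x_pw = 2 ^ κ) :
    startTables.wp y (fun τ => TableCtx G U b κ τ ∧ Table G U b κ τ) σ := by
  unfold startTables
  refine wp_seq_of (R := fun τ => ∀ v ≤ n, τ.arr a_off v = v * 2 ^ κ)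
    (wp_fillMultiples hC.num hny hpw (by decide) fun τ _ h => h) ?_
  intro σ₁ hF₁ hoff
  have hT₁ : TableCtx G U b κ σ₁ := by
    refine ⟨hC.frame hF₁ rfl rfl rfl rfl, hU.frame hF₁ rfl, fun v => ?_,
      (hF₁.var x_pw rfl).trans hpw, fun v => hoff v v.isLt.le⟩
    rw [hF₁.arr a_bit rfl]; exact hbit v
  refine wp_forTo (fun j ρ => ∀ v : Fin n, (v : ℕ) < j → (∀ X < 2 ^ κ,
      Entry G U b (ρ.arr a_fam (v * 2 ^ κ + X)) (ρ.arr a_cost (v * 2 ^ κ + X)) v X) ∧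
      ρ.arr a_cost (v * 2 ^ κ + b v) = 0) (m := n) hT₁.ctx.num hny (by decide) rfl rfl
    (fun _ _ _ h => h) (fun v h => absurd h (Nat.not_lt_zero _)) ?_ ?_
  · intro j ρ hj hF hv hI
    obtain ⟨w, rfl⟩ : ∃ z : Fin n, (z : ℕ) = j := ⟨⟨j, hj⟩, rfl⟩
    have hT : TableCtx G U b κ ρ := hT₁.frame hF rfl rfl (by decide)
    refine wp_seq_of (R := fun τ => (∀ v : Fin n, (v : ℕ) < w → (∀ X < 2 ^ κ,
        Entry G U b (τ.arr a_fam (v * 2 ^ κ + X)) (τ.arr a_cost (v * 2 ^ κ + X)) v X) ∧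
        τ.arr a_cost (v * 2 ^ κ + b v) = 0) ∧ ∀ X < 2 ^ κ,
        τ.arr a_fam (w * 2 ^ κ + X) = 2 ^ n - 1 ∧ τ.arr a_cost (w * 2 ^ κ + X) = n) ?_ ?_
    · refine wp_forTo (fun j τ => (∀ v : Fin n, (v : ℕ) < w → (∀ X < 2 ^ κ,
        Entry G U b (τ.arr a_fam (v * 2 ^ κ + X)) (τ.arr a_cost (v * 2 ^ κ + X)) v X) ∧
        τ.arr a_cost (v * 2 ^ κ + b v) = 0) ∧ ∀ X < j,
        τ.arr a_fam (w * 2 ^ κ + X) = 2 ^ n - 1 ∧ τ.arr a_cost (w * 2 ^ κ + X) = n)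
        (m := 2 ^ κ) hT.size hκy (by decide) rfl rfl (fun _ _ _ h => h)
        ⟨hI, fun X h => absurd h (Nat.not_lt_zero _)⟩ ?_ fun τ _ h => h
      rintro Y ρ' hY hF' hX ⟨h1, h2⟩
      have hT' : TableCtx G U b κ ρ' := hT.frame hF' rfl rfl (by decide)
      have hv' : ρ'.var x_v = w := (hF'.var x_v rfl).trans hv
      simp only [wp_seq, wp_write, Exp.val_read, Exp.val_add, Exp.val_sub, Exp.val_var,
        Exp.val_const, State.setArr_var, State.setArr_arr, hv', hX, hT'.ctx.num,
        hT'.ctx.pow n le_rfl, hT'.off, Nat.reduceEqDiff, true_and, false_and, if_false]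
      refine ⟨fun v hvw => ?_, fun X hXY => ?_⟩
      · have hne : ∀ X < 2 ^ κ, ¬ ((v : ℕ) * 2 ^ κ + X = w * 2 ^ κ + Y) := fun X hX h =>
          absurd ((cell_inj hX hY).mp h).1 (by omega)
        refine ⟨fun X hX => ?_, ?_⟩
        · rw [if_neg (hne X hX), if_neg (hne X hX)]
          exact (h1 v hvw).1 X hX
        · rw [if_neg (hne _ (hb.lt v))]
          exact (h1 v hvw).2
      · by_cases h : X = Y
        · simp [h]
        · rw [if_neg (by omega), if_neg (by omega)]
          exact h2 X (by omega)
    · rintro ρ' hF' ⟨h1, h2⟩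
      have hT' : TableCtx G U b κ ρ' := hT.frame hF' rfl rfl (by decide)
      have hv' : ρ'.var x_v = w := (hF'.var x_v rfl).trans hv
      simp only [wp_seq, wp_write, Exp.val_read, Exp.val_add, Exp.val_var,
        Exp.val_const, State.setArr_var, State.setArr_arr, hv', hT'.ctx.pow w w.isLt.le, hT'.off,
        hT'.bit, Nat.reduceEqDiff, true_and, false_and, if_false]
      intro v hvw
      rcases Nat.lt_succ_iff_lt_or_eq.mp hvw with h | h
      · have hne : ∀ X < 2 ^ κ, ¬ ((v : ℕ) * 2 ^ κ + X = w * 2 ^ κ + b w) := fun X hX e =>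
          absurd ((cell_inj hX (hb.lt w)).mp e).1 (by omega)
        refine ⟨fun X hX => ?_, ?_⟩
        · rw [if_neg (hne X hX), if_neg (hne X hX)]
          exact (h1 v h).1 X hX
        · rw [if_neg (hne _ (hb.lt v))]
          exact (h1 v h).2
      · obtain rfl : v = w := Fin.ext h
        refine ⟨fun X hX => ?_, by simp⟩
        by_cases hXb : X = b v
        · subst hXb
          simpa using Entry.single G U b v
        · rw [if_neg (by omega), if_neg (by omega), (h2 X hX).1, (h2 X hX).2]
          exact .full hG U hb v hX
  · intro ρ hF hI
    exact ⟨hT₁.frame hF rfl rfl (by decide), fun v => (hI v v.isLt).1, fun v => (hI v v.isLt).2⟩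

/-- Tries to improve the entry for the root `x_v` and the terminals of `x_X` and `x_Y` by the union
of the set for `x_v` and `x_X` with the set for `x_u` and `x_Y`. -/
def relax : Prog :=
  x_a ≔ x_X ;; x_b ≔ x_Y ;; bitOr ;; x_msk ≔ x_or ;;
  x_a ≔ a_fam⟪a_off⟪x_v⟫ + x_X⟫ ;; x_b ≔ a_fam⟪a_off⟪x_u⟫ + x_Y⟫ ;; bitOr ;;
  x_s ≔ ((a_cost⟪a_off⟪x_v⟫ + x_X⟫ + a_cost⟪a_off⟪x_u⟫ + x_Y⟫) + (.const 1 - a_set⟪x_u⟫)) ;;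
  .cond (a_cost⟪a_off⟪x_v⟫ + x_msk⟫ - x_s)
    (a_cost⟪a_off⟪x_v⟫ + x_msk⟫ ≔ x_s ;; a_fam⟪a_off⟪x_v⟫ + x_msk⟫ ≔ x_or) .skip

/-- `n` rounds of relaxations with all pairs of entries at the ends of edges. -/
def rounds : Prog :=
  forTo x_i x_n (forTo x_X x_pw (forTo x_Y x_pw (forTo x_v x_n (forTo x_u x_n
    (.cond a_adj⟪a_row⟪x_v⟫ + x_u⟫ relax .skip)))))

theorem wp_relax {y n κ : ℕ} {G : SimpleGraph (Fin n)} {U A : Finset (Fin n)}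
    {b : Fin n → ℕ} {σ : State} (hny : n ≤ y) (hκn : κ ≤ n)
    (hb : IsBits b A κ) (hT : TableCtx G U b κ σ) (hE : Table G U b κ σ) {X Y : ℕ} {v u : Fin n}
    (hX : X < 2 ^ κ) (hY : Y < 2 ^ κ) (hXσ : σ.var x_X = X) (hYσ : σ.var x_Y = Y)
    (hv : σ.var x_v = v) (hu : σ.var x_u = u) (hvu : G.Adj v u) :
    relax.wp y (fun τ => Table G U b κ τ ∧ (∀ i, τ.arr a_cost i ≤ σ.arr a_cost i) ∧
      τ.arr a_cost (v * 2 ^ κ + (X ||| Y)) ≤ σ.arr a_cost (v * 2 ^ κ + X) +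
        σ.arr a_cost (u * 2 ^ κ + Y) + (if u ∈ U then 0 else 1)) σ := by
  have hXY : X ||| Y < 2 ^ κ := Nat.or_lt_two_pow hX hY
  have h2n : 2 ^ κ ≤ 2 ^ n := Nat.pow_le_pow_right (by norm_num) hκn
  rw [relax, wp_seq, wp_assign, wp_seq, wp_assign]
  simp only [Exp.val_var, State.setVar_var, Nat.reduceEqDiff, if_false, hXσ, hYσ]
  refine wp_seq_of (R := fun τ => τ.var x_or = (X ||| Y)) (wp_bitOr (k := n) hny
    (by simpa using hX.trans_le h2n) (by simpa using hY.trans_le h2n)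
    fun τ _ h => by simpa using h) ?_
  intro σ₁ hF₁ h₁
  have hvar₁ : ∀ x, x ≠ x_a → x ≠ x_b → x ≠ x_p → x ≠ x_or → σ₁.var x = σ.var x := by
    intro x g1 g2 g3 g4
    rw [hF₁.var x (by simp [bitOr, Prog.modVar, g1, g2, g3, g4])]
    simp [g1, g2]
  have harr₁ : ∀ a, σ₁.arr a = σ.arr a := fun a => by rw [hF₁.arr a rfl]; rfl
  have hv₁ : σ₁.var x_v = v := (hvar₁ _ (by decide) (by decide) (by decide) (by decide)).trans hv
  have hu₁ : σ₁.var x_u = u := (hvar₁ _ (by decide) (by decide) (by decide) (by decide)).trans hu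
  have hX₁ : σ₁.var x_X = X := (hvar₁ _ (by decide) (by decide) (by decide) (by decide)).trans hXσ
  have hY₁ : σ₁.var x_Y = Y := (hvar₁ _ (by decide) (by decide) (by decide) (by decide)).trans hYσ
  rw [wp_seq, wp_assign, wp_seq, wp_assign, wp_seq, wp_assign]
  simp only [Exp.val_var, Exp.val_read, Exp.val_add, State.setVar_var, State.setVar_arr,
    Nat.reduceEqDiff, if_false, hv₁, hu₁, hX₁, hY₁, h₁, harr₁, hT.off]
  have e1 := hE.entry v X hX
  have e2 := hE.entry u Y hY
  set f₁ := σ.arr a_fam (v * 2 ^ κ + X)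
  set f₂ := σ.arr a_fam (u * 2 ^ κ + Y)
  refine wp_seq_of (R := fun τ => τ.var x_or = (f₁ ||| f₂)) (wp_bitOr (k := n) hny
    (by simpa using e1.lt) (by simpa using e2.lt) fun τ _ h => by simpa using h) ?_
  intro σ₂ hF₂ h₂
  have harr₂ : ∀ a, σ₂.arr a = σ.arr a := fun a => by
    rw [hF₂.arr a rfl]; exact harr₁ a
  have hv₂ : σ₂.var x_v = v := by rw [hF₂.var x_v rfl]; simpa using hv₁
  have hu₂ : σ₂.var x_u = u := by rw [hF₂.var x_u rfl]; simpa using hu₁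
  have hX₂ : σ₂.var x_X = X := by rw [hF₂.var x_X rfl]; simpa using hX₁
  have hY₂ : σ₂.var x_Y = Y := by rw [hF₂.var x_Y rfl]; simpa using hY₁
  have hm₂ : σ₂.var x_msk = (X ||| Y) := by rw [hF₂.var x_msk rfl]; simp
  have hw : 1 - (if u ∈ U then 1 else 0) = if u ∈ U then 0 else 1 := by split_ifs <;> rfl
  simp only [wp_seq, wp_assign, wp_cond, wp_write, wp_skip, Exp.val_var, Exp.val_read, Exp.val_add,
    Exp.val_sub, Exp.val_const, State.setVar_var, State.setVar_arr, State.setArr_arr,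
    State.setArr_var, Nat.reduceEqDiff, if_false, if_true, false_and, true_and, hv₂, hu₂, hX₂, hY₂,
    hm₂, h₂, harr₂, hT.off, hT.set u, hw]
  set s := σ.arr a_cost (v * 2 ^ κ + X) + σ.arr a_cost (u * 2 ^ κ + Y) + (if u ∈ U then 0 else 1)
  refine ⟨fun h => ⟨⟨fun v' X' hX' => ?_, fun v' => ?_⟩, fun i => ?_, ?_⟩, fun h => ⟨⟨?_, ?_⟩, ?_, ?_⟩⟩
  · simp only [State.setArr_arr, State.setVar_arr, Nat.reduceEqDiff, false_and, true_and, if_false,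
      harr₂, cell_inj hX' hXY, Fin.val_inj]
    by_cases hc : v' = v ∧ X' = (X ||| Y)
    · obtain ⟨rfl, rfl⟩ := hc
      simpa using e1.union e2 hvu
    · rw [if_neg hc, if_neg hc]
      exact hE.entry v' X' hX'
  · simp only [State.setArr_arr, State.setVar_arr, Nat.reduceEqDiff, false_and, true_and, if_false,
      harr₂, cell_inj (hb.lt v') hXY, Fin.val_inj]
    split_ifs with hc
    · have := hE.single v'
      rw [hc.2, hc.1] at this
      omega
    · exact hE.single v'
  · split_ifs with hc
    · rw [hc]; omega
    · exact le_rfl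
  · simp
  · simpa [harr₂] using hE.entry
  · simpa [harr₂] using hE.single
  · exact fun _ => le_rfl
  · omega

theorem wp_round {y n κ : ℕ} {G : SimpleGraph (Fin n)} {U A : Finset (Fin n)}
    {b : Fin n → ℕ} {σ : State} (hny : n ≤ y) (hκy : 2 ^ κ ≤ y) (hκn : κ ≤ n)
    (hb : IsBits b A κ) (hT : TableCtx G U b κ σ) (hE : Table G U b κ σ) :
    (forTo x_X x_pw (forTo x_Y x_pw (forTo x_v x_n (forTo x_u x_n
      (.cond a_adj⟪a_row⟪x_v⟫ + x_u⟫ relax .skip))))).wp y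
      (fun τ => Table G U b κ τ ∧ ∀ X < 2 ^ κ, ∀ Y < 2 ^ κ, ∀ v u : Fin n, G.Adj v u →
        τ.arr a_cost (v * 2 ^ κ + (X ||| Y)) ≤ σ.arr a_cost (v * 2 ^ κ + X) +
          σ.arr a_cost (u * 2 ^ κ + Y) + (if u ∈ U then 0 else 1)) σ := by
  classical
  -- Costs only decrease, which keeps the upper bounds obtained earlier in the round.
  let R : State → State → Prop := fun ρ τ => ∀ i, τ.arr a_cost i ≤ ρ.arr a_cost i
  have hR' : ∀ ρ τ υ, R ρ τ → R τ υ → R ρ υ := fun _ _ _ h h' i => (h' i).trans (h i)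
  let B : ℕ → ℕ → Fin n → Fin n → State → Prop := fun X Y v u τ => G.Adj v u →
    τ.arr a_cost (v * 2 ^ κ + (X ||| Y)) ≤ σ.arr a_cost (v * 2 ^ κ + X) +
      σ.arr a_cost (u * 2 ^ κ + Y) + (if u ∈ U then 0 else 1)
  have hB : ∀ X Y v u ρ τ, R ρ τ → B X Y v u ρ → B X Y v u τ :=
    fun X Y v u ρ τ h h' hvu => (h _).trans (h' hvu)
  have hJ : ∀ (i : ℕ) (ρ : State) (k : ℕ), Table G U b κ ρ → Table G U b κ (ρ.setVar i k) :=
    fun i ρ k h => ⟨h.entry, h.single⟩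
  refine wp_forTo_forall (Table G U b κ) R (fun X τ => ∀ Y < 2 ^ κ, ∀ v u, B X Y v u τ)
    hT.size hκy (by decide) rfl rfl (fun _ _ => le_rfl) hR'
    (fun X ρ τ h h' Y hY v u => hB _ _ _ _ _ _ h (h' Y hY v u))
    (hJ _) (fun _ _ _ => le_rfl) hE ?_ (fun ρ _ h1 _ h2 => ⟨h1, fun X hX Y hY v u => h2 X hX Y hY v u⟩)
  intro X ρ₁ hX hF₁ hX₁ hE₁ hR₁
  have hT₁ : TableCtx G U b κ ρ₁ := hT.frame hF₁ rfl rfl (by decide)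
  refine wp_forTo_forall (Table G U b κ) R (fun Y τ => ∀ v u, B X Y v u τ)
    hT₁.size hκy (by decide) rfl rfl (fun _ _ => le_rfl) hR'
    (fun Y ρ τ h h' v u => hB _ _ _ _ _ _ h (h' v u))
    (hJ _) (fun _ _ _ => le_rfl) hE₁ ?_ (fun ρ _ h1 h2 h3 => ⟨h1, h2, h3⟩)
  intro Y ρ₂ hY hF₂ hY₂ hE₂ hR₂
  have hT₂ : TableCtx G U b κ ρ₂ := hT₁.frame hF₂ rfl rfl (by decide)
  refine wp_forTo_forall (Table G U b κ) R
    (fun j τ => ∀ v : Fin n, (v : ℕ) = j → ∀ u, B X Y v u τ)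
    hT₂.ctx.num hny (by decide) rfl rfl (fun _ _ => le_rfl) hR'
    (fun Y ρ τ h h' v hv u => hB _ _ _ _ _ _ h (h' v hv u))
    (hJ _) (fun _ _ _ => le_rfl) hE₂ ?_ (fun ρ _ h1 h2 h3 => ⟨h1, h2, fun v => h3 v v.isLt v rfl⟩)
  intro j ρ₃ hj hF₃ hv₃ hE₃ hR₃
  obtain ⟨v, rfl⟩ : ∃ z : Fin n, (z : ℕ) = j := ⟨⟨j, hj⟩, rfl⟩
  have hT₃ : TableCtx G U b κ ρ₃ := hT₂.frame hF₃ rfl rfl (by decide)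
  refine wp_forTo_forall (Table G U b κ) R
    (fun j τ => ∀ u : Fin n, (u : ℕ) = j → B X Y v u τ)
    hT₃.ctx.num hny (by decide) rfl rfl (fun _ _ => le_rfl) hR'
    (fun Y ρ τ h h' u hu => hB _ _ _ _ _ _ h (h' u hu))
    (hJ _) (fun _ _ _ => le_rfl) hE₃ ?_ (fun ρ _ h1 h2 h3 => ⟨h1, h2, fun v' hv' u => by
      obtain rfl := Fin.ext hv'
      exact h3 u u.isLt u rfl⟩)
  intro j ρ₄ hj hF₄ hu₄ hE₄ hR₄
  obtain ⟨u, rfl⟩ : ∃ z : Fin n, (z : ℕ) = j := ⟨⟨j, hj⟩, rfl⟩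
  have hT₄ : TableCtx G U b κ ρ₄ := hT₃.frame hF₄ rfl rfl (by decide)
  have hX₄ : ρ₄.var x_X = X := by
    rw [hF₄.var x_X rfl, hF₃.var x_X rfl, hF₂.var x_X rfl, hX₁]
  have hY₄ : ρ₄.var x_Y = Y := by rw [hF₄.var x_Y rfl, hF₃.var x_Y rfl, hY₂]
  have hv₄ : ρ₄.var x_v = v := by rw [hF₄.var x_v rfl, hv₃]
  have hle : R σ ρ₄ := hR' _ _ _ hR₁ (hR' _ _ _ hR₂ (hR' _ _ _ hR₃ hR₄))
  simp only [wp_cond, wp_skip, Exp.val_read, Exp.val_add, Exp.val_var, hv₄, hu₄, hT₄.ctx.row,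
    hT₄.ctx.adj, ne_eq, ite_eq_right_iff, one_ne_zero, imp_false, not_not]
  refine ⟨fun hvu => ?_, fun hvu => ⟨hE₄, fun _ => le_rfl, fun u' hu' hvu' => ?_⟩⟩
  · refine Prog.wp_mono (wp_relax hny hκn hb hT₄ hE₄ hX hY hX₄ hY₄ hv₄ hu₄ hvu) ?_
    rintro τ ⟨h1, h2, h3⟩
    refine ⟨h1, h2, fun u' hu' _ => ?_⟩
    obtain rfl := Fin.ext hu'
    refine h3.trans ?_
    have g1 := hle (v * 2 ^ κ + X)
    have g2 := hle (u' * 2 ^ κ + Y)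
    omega
  · exact absurd ((Fin.ext hu' : u' = u) ▸ hvu') hvu

theorem wp_rounds {y n κ : ℕ} {G : SimpleGraph (Fin n)} {U A : Finset (Fin n)}
    {b : Fin n → ℕ} {σ : State} (hny : n ≤ y) (hκy : 2 ^ κ ≤ y) (hκn : κ ≤ n)
    (hb : IsBits b A κ) (hT : TableCtx G U b κ σ) (hE : Table G U b κ σ) :
    rounds.wp y (fun τ => Table G U b κ τ ∧
      BestUpTo G U b κ (fun v X => τ.arr a_cost (v * 2 ^ κ + X)) n) σ := by
  unfold rounds
  refine wp_forTo (fun j τ => Table G U b κ τ ∧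
      BestUpTo G U b κ (fun v X => τ.arr a_cost (v * 2 ^ κ + X)) j) hT.ctx.num hny (by decide)
    rfl rfl (fun j ρ k h => ⟨⟨h.1.entry, h.1.single⟩, h.2⟩) ⟨hE, .zero U _⟩ ?_ (fun _ _ h => h)
  rintro j ρ hj hF hi ⟨h1, h2⟩
  refine Prog.wp_mono (wp_round hny hκy hκn hb (hT.frame hF rfl rfl (by decide)) h1) ?_
  rintro τ ⟨h3, h4⟩
  exact ⟨h3, h2.succ hb h3.single h4⟩

/-- Adds to `U` the optimal set for the root `x_root` and all chosen terminals. -/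
def addSet : Prog :=
  x_f ≔ a_fam⟪a_off⟪x_root⟫ + (x_pw - .const 1)⟫ ;;
  forTo x_v x_n (.cond (Exp.odd x_f) (a_set⟪x_v⟫ ≔ .const 1) .skip ;; x_f ≔ .half x_f)

theorem wp_addSet {y n κ : ℕ} {G : SimpleGraph (Fin n)} {U : Finset (Fin n)}
    {b : Fin n → ℕ} {σ : State} (hny : n ≤ y) (hT : TableCtx G U b κ σ) {v : Fin n}
    (hv : σ.var x_root = v) :
    addSet.wp y (HasSet (U ∪ bitSet (σ.arr a_fam (v * 2 ^ κ + (2 ^ κ - 1))))) σ := by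
  rw [addSet, wp_seq, wp_assign]
  simp only [Exp.val_read, Exp.val_add, Exp.val_sub, Exp.val_var, Exp.val_const, hv, hT.size,
    hT.off]
  set f := σ.arr a_fam (v * 2 ^ κ + (2 ^ κ - 1))
  refine wp_forTo (fun j ρ => ρ.var x_f = f / 2 ^ j ∧ ∀ u : Fin n, ρ.arr a_set u =
      if u ∈ U ∨ ((u : ℕ) < j ∧ f.testBit u = true) then 1 else 0) (m := n)
    (by simpa using hT.ctx.num) hny (by decide) rfl rfl
    (fun _ _ _ h => ⟨by simpa using h.1, h.2⟩) ?_ ?_ ?_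
  · exact ⟨by simp, fun u => by simpa using hT.set u⟩
  · rintro j ρ hj hF hu ⟨h1, h2⟩
    obtain ⟨w, rfl⟩ : ∃ z : Fin n, (z : ℕ) = j := ⟨⟨j, hj⟩, rfl⟩
    have hbit : f / 2 ^ (w : ℕ) % 2 = if f.testBit w = true then 1 else 0 := by
      rw [Nat.testBit_eq_decide_div_mod_eq]
      rcases Nat.mod_two_eq_zero_or_one (f / 2 ^ (w : ℕ)) with h | h <;> simp [h]
    have hstep : ∀ u : Fin n, u ≠ w → ((u : ℕ) < w + 1 ↔ (u : ℕ) < w) := by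
      intro u huw
      have : (u : ℕ) ≠ w := fun e => huw (Fin.ext e)
      omega
    simp only [wp_seq, wp_cond, wp_write, wp_assign, wp_skip, Exp.val_odd, Exp.val_half,
      Exp.val_var, Exp.val_const, h1, hbit, hu, State.setVar_var, State.setVar_arr,
      State.setArr_var, State.setArr_arr, Nat.div_div_eq_div_mul, if_true, true_and, Fin.val_inj,
      ne_eq, ite_eq_right_iff, one_ne_zero, imp_false, not_not, pow_succ]
    refine ⟨fun hw u => ?_, fun hw u => ?_⟩
    · by_cases huw : u = w
      · subst huw; simp [hw]
      · rw [if_neg huw, h2 u]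
        simp only [hstep u huw]
    · rw [h2 u]
      by_cases huw : u = w
      · subst huw; simp [hw]
      · simp only [hstep u huw]
  · rintro ρ hF ⟨h1, h2⟩ u
    rw [h2 u]
    simp [mem_bitSet]

/-- Joins up to `x_g + 1` components by an optimal set of vertices. -/
def mergeStep : Prog := select ;; startTables ;; rounds ;; addSet ;; label

theorem wp_mergeStep {y n g : ℕ} {G : SimpleGraph (Fin n)} {S U : Finset (Fin n)} {σ : State}
    (hny : n ≤ y) (hgy : 2 ^ (g + 1) ≤ y) (hG : G.Connected) (hC : Ctx G σ) (hU : HasSet U σ)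
    (hLab : Labelled G U σ) (hg : σ.var x_g = g) (hanch : Anchored G S U) (hU0 : U.Nonempty) :
    mergeStep.wp y (fun τ => ∃ W, HasSet W τ ∧ Labelled G W τ ∧ U ⊆ W ∧ Anchored G S W ∧
      numComp G W + min (numComp G U) (g + 1) ≤ numComp G U + 1 ∧
      ∀ B v, Rooted G B v → S ⊆ B → W.card ≤ U.card + (B \ U).card) σ := by
  obtain ⟨H, L, hJ, hL, hk⟩ := hLab
  unfold mergeStep
  refine wp_seq_of (wp_select hny hC hU hJ hL hg) ?_
  rintro σ₁ hF₁ ⟨A, b, κ, hb, hA, hbit, hpw, hκ, hroot⟩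
  have hkn : numComp G U ≤ n :=
    (numComp_le_card U fun x hx => ⟨x, hx, .rfl⟩).trans ((Finset.card_le_univ U).trans (by simp))
  have hk1 : 1 ≤ numComp G U := one_le_numComp hU0
  have hκn : κ ≤ n := by omega
  have hκy : 2 ^ κ ≤ y := (Nat.pow_le_pow_right (by norm_num) (by omega)).trans hgy
  have hA0 : A.Nonempty := Finset.card_pos.mp (by rw [hb.card]; omega)
  obtain ⟨v, hvA, hv⟩ := hroot hA0
  have hAU : A ⊆ U := fun a ha => by
    obtain ⟨u, hu, rfl⟩ := Finset.mem_image.mp (hA ha)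
    exact hL.mem hu
  refine wp_seq_of (wp_startTables hny hκy hG hb (hC.frame hF₁ rfl rfl rfl rfl)
    (hU.frame hF₁ rfl) hbit hpw) ?_
  rintro σ₂ hF₂ ⟨hT₂, hE₂⟩
  refine wp_seq_of (wp_rounds hny hκy hκn hb hT₂ hE₂) ?_
  rintro σ₃ hF₃ ⟨hE₃, hbest⟩
  have hT₃ : TableCtx G U b κ σ₃ := hT₂.frame hF₃ rfl rfl (by decide)
  have hv₃ : σ₃.var x_root = v := by rw [hF₃.var x_root rfl, hF₂.var x_root rfl, hv]
  have hlast : 2 ^ κ - 1 < 2 ^ κ := Nat.sub_lt (by positivity) (by norm_num)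
  have hent := hE₃.entry v _ hlast
  refine wp_seq_of (wp_addSet hny hT₃ hv₃) ?_
  intro σ₄ hF₄ hU₄
  set F : Finset (Fin n) := bitSet (σ₃.arr a_fam (v * 2 ^ κ + (2 ^ κ - 1)))
  have hC₄ : Ctx G σ₄ := hT₃.ctx.frame hF₄ rfl rfl rfl rfl
  refine Prog.wp_mono (Prog.wp_frame (wp_label hny hC₄ hU₄)) ?_
  rintro τ ⟨hτ, hF₅⟩
  have hAF : A ⊆ F := hb.subset_of_covers hent.covers
  have hFv : ∀ x ∈ F, (inside G (U ∪ F)).Reachable x v := fun x hx =>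
    (reachable_mono Finset.subset_union_right (hent.rooted.2 x hx)).symm
  have hnew : ∀ x ∈ U ∪ F, x ∉ U → (inside G (U ∪ F)).Reachable x v := fun x hx hxU =>
    hFv x ((Finset.mem_union.mp hx).resolve_left hxU)
  refine ⟨U ∪ F, hU₄.frame hF₅ rfl, hτ, Finset.subset_union_left,
    hanch.extend Finset.subset_union_left (hAU hvA) .rfl hnew, ?_, ?_⟩
  · have := numComp_add_card_le hL Finset.subset_union_left hA hnew fun a ha => hFv a (hAF ha)
    rwa [hb.card, hκ] at this
  · intro B w hB hSB
    have hvB : v ∈ B ∪ U := Finset.mem_union_right _ (hAU hvA)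
    obtain ⟨X, hX, hXm, hXc⟩ := hbest (B ∪ U) v ((hB.union_anchored hSB hanch).change hvB)
      ((Finset.card_le_univ _).trans (by simp))
    rw [hb.eq_of_isMask (hAU.trans Finset.subset_union_right) hX hXm] at hXc
    have h1 : (F \ insert v U).card ≤ ((B ∪ U) \ insert v U).card := hent.card_le.trans hXc
    rw [Finset.insert_eq_of_mem (hAU hvA), Finset.union_sdiff_right] at h1
    have h2 : (U ∪ F).card = U.card + (F \ U).card := by
      rw [← Finset.card_union_of_disjoint Finset.disjoint_sdiff, Finset.union_sdiff_self_eq_union]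
    omega

/-- Joins components, `x_g + 1` at a time, until only one is left. -/
def merge : Prog := .loop (x_k - .const 1) mergeStep

theorem wp_merge {y n g q : ℕ} {G : SimpleGraph (Fin n)} {S U : Finset (Fin n)} {σ : State}
    (hny : n ≤ y) (hgy : 2 ≤ numComp G U → 2 ^ (g + 1) ≤ y) (hG : G.Connected) (hC : Ctx G σ)
    (hU : HasSet U σ) (hLab : Labelled G U σ) (hg : σ.var x_g = g) (hg1 : 1 ≤ g) (hSU : S ⊆ U)
    (hanch : Anchored G S U) (hU0 : U.Nonempty) (hq : numComp G U - 1 ≤ g * q) :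
    merge.wp y (fun τ => ∃ W, HasSet W τ ∧ Labelled G W τ ∧ numComp G W ≤ 1 ∧ S ⊆ W ∧
      W.Nonempty ∧
      ∀ B v, Rooted G B v → S ⊆ B → W.card ≤ U.card + q * (B \ S).card) σ := by
  have hkn : numComp G U ≤ n :=
    (numComp_le_card U fun x hx => ⟨x, hx, .rfl⟩).trans ((Finset.card_le_univ U).trans (by simp))
  unfold merge
  refine Prog.wp_loop (fun k ρ => ∃ W j, HasSet W ρ ∧ Labelled G W ρ ∧ S ⊆ W ∧ Anchored G S W ∧
      W.Nonempty ∧ numComp G W ≤ k + 1 ∧ numComp G W ≤ numComp G U ∧ numComp G W - 1 ≤ g * j ∧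
      ∀ B v, Rooted G B v → S ⊆ B →
        W.card + j * (B \ S).card ≤ U.card + q * (B \ S).card) (k := n) hny ?_ ?_ ?_
  · exact ⟨U, q, hU, hLab, hSU, hanch, hU0, by omega, le_rfl, hq, fun _ _ _ _ => le_rfl⟩
  · rintro k ρ hF ⟨W, j, h1, h2, h3, h4, h5, h6, h7, h8, h9⟩ he
    have hk : ρ.var x_k = numComp G W := by obtain ⟨_, _, _, _, h⟩ := h2; exact h
    simp only [Exp.val_sub, Exp.val_var, Exp.val_const, hk] at he
    obtain ⟨j, rfl⟩ : ∃ i, j = i + 1 := by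
      refine Nat.exists_eq_succ_of_ne_zero ?_
      rintro rfl
      omega
    refine ⟨k - 1, by omega, Prog.wp_mono (wp_mergeStep hny (hgy (by omega)) hG
      (hC.frame hF rfl rfl rfl rfl) h1 h2 ((hF.var x_g rfl).trans hg) h4 h5) ?_⟩
    rintro τ ⟨W', g1, g2, g3, g4, g5, g6⟩
    rw [Nat.mul_succ] at h8
    refine ⟨W', j, g1, g2, h3.trans g3, g4, h5.mono g3, by omega, by omega, by omega, ?_⟩
    intro B v hB hSB
    have e1 := h9 B v hB hSB
    have e2 := g6 B v hB hSB
    have e3 := Finset.card_le_card (Finset.sdiff_subset_sdiff (le_refl B) h3)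
    rw [Nat.succ_mul] at e1
    omega
  · rintro k ρ hF ⟨W, j, h1, h2, h3, h4, h5, h6, h7, h8, h9⟩ he
    have hk : ρ.var x_k = numComp G W := by obtain ⟨_, _, _, _, h⟩ := h2; exact h
    simp only [Exp.val_sub, Exp.val_var, Exp.val_const, hk] at he
    refine ⟨W, h1, h2, by omega, h3, h5, fun B v hB hSB => ?_⟩
    have := h9 B v hB hSB
    omega

/-! ### The algorithm -/

/-- Copies the terminal set, and replaces it by a single vertex if it is empty. -/
def copyTerminals : Prog :=
  x_s ≔ .const 0 ;;
  forTo x_v x_n (a_set⟪x_v⟫ ≔ a_term⟪x_v⟫ ;; x_s ≔ (x_s + a_term⟪x_v⟫)) ;;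
  .cond x_s .skip (a_set⟪.const 0⟫ ≔ .const 1)

theorem wp_copyTerminals {y n : ℕ} {S : Finset (Fin n)} {σ : State} (hny : n ≤ y) (hn0 : 0 < n)
    (hn : σ.var x_n = n) (hS : ∀ v : Fin n, σ.arr a_term v = if v ∈ S then 1 else 0) :
    copyTerminals.wp y (fun τ => ∃ S₀ : Finset (Fin n), HasSet S₀ τ ∧
      ((S.Nonempty ∧ S₀ = S) ∨ (S = ∅ ∧ ∃ v, S₀ = {v}))) σ := by
  rw [copyTerminals, wp_seq, wp_assign, Exp.val_const]
  refine wp_seq_of (R := fun τ => HasSet S τ ∧ τ.var x_s = S.card) ?_ ?_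
  · refine wp_forTo (fun j ρ => (∀ v : Fin n, (v : ℕ) < j → ρ.arr a_set v =
        if v ∈ S then 1 else 0) ∧ ρ.var x_s = (Finset.univ.filter fun z : Fin n =>
        (z : ℕ) < j ∧ z ∈ S).card) (m := n) (by simpa using hn) hny (by decide) rfl rfl
      (fun _ _ _ h => ⟨h.1, by simpa using h.2⟩) (by simp) ?_ ?_
    · rintro j ρ hj hF hv ⟨h1, h2⟩
      obtain ⟨w, rfl⟩ : ∃ z : Fin n, (z : ℕ) = j := ⟨⟨j, hj⟩, rfl⟩
      have hw : ρ.arr a_term w = if w ∈ S then 1 else 0 := by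
        rw [hF.arr a_term rfl]; simpa using hS w
      simp only [wp_seq, wp_write, wp_assign, Exp.val_read, Exp.val_add, Exp.val_var, hv, hw, h2,
        State.setArr_var, State.setArr_arr, State.setVar_var, State.setVar_arr, if_true, true_and,
        Nat.reduceEqDiff, if_false, card_filter_lt_succ, and_true]
      intro v hvw
      by_cases h3 : (v : ℕ) = w
      · rw [if_pos h3, Fin.ext h3]
      · rw [if_neg h3, h1 v (by omega)]
    · rintro ρ hF ⟨h1, h2⟩
      refine ⟨fun v => h1 v v.isLt, ?_⟩
      rw [h2]
      congr 1
      ext z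
      simp
  · rintro τ hF ⟨h1, h2⟩
    simp only [wp_cond, wp_skip, wp_write, Exp.val_var, Exp.val_const, h2]
    refine ⟨fun h => ⟨S, h1, .inl ⟨Finset.card_ne_zero.mp h, rfl⟩⟩, fun h => ?_⟩
    have hS0 : S = ∅ := Finset.card_eq_zero.mp h
    refine ⟨{⟨0, hn0⟩}, ?_, .inr ⟨hS0, _, rfl⟩⟩
    have := h1.insert ⟨0, hn0⟩
    rwa [hS0, insert_empty_eq] at this

/-- The approximation algorithm: the bound `x_t` for the number of visible components is about
`1 / r`, and the number `x_q` of optimal Steiner trees to be combined is about `1 + r`. -/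
def approxSteiner : Prog :=
  fillMultiples a_row x_n ;; fillPowers ;; copyTerminals ;;
  divide x_t x_den x_num ;; divide x_q (x_num + .const 1) x_den ;;
  grow ;; divide x_g (x_k - .const 1) x_q ;; merge

/-- The approximation ratio: `a` vertices are added before the optimal Steiner trees, `q` of which
are combined, each with at most `x` further vertices. -/
theorem ratio_bound {n s a t q x w p d : ℕ} (hp : 0 < p) (hd : 0 < d) (hsn : s ≤ n)
    (ha : a * t + 1 ≤ s) (ht : d ≤ t * p ∨ n ≤ t) (hq : q = 1 ∨ (q - 1) * d < p + 1 ∧ q ≤ n)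
    (hq1 : 1 ≤ q) (hw : w ≤ s + a + q * x) :
    (w : ℝ) - 1 ≤ (1 + (p : ℝ) / d) * ((s + x : ℕ) - 1) := by
  have hd' : (0 : ℝ) < d := by exact_mod_cast hd
  have hp' : (0 : ℝ) < p := by exact_mod_cast hp
  set r : ℝ := (p : ℝ) / d with hr
  have hr0 : 0 < r := div_pos hp' hd'
  have hrd : r * d = p := div_mul_cancel₀ _ hd'.ne'
  have hs1 : (a : ℝ) * t + 1 ≤ s := by exact_mod_cast ha
  have hqr : (q : ℝ) ≤ 1 + r := by
    rcases hq with h | ⟨h, _⟩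
    · rw [h]; push_cast; linarith
    · obtain ⟨m, rfl⟩ := Nat.exists_eq_add_of_le hq1
      rw [Nat.add_sub_cancel_left] at h
      have h' : (m : ℝ) * d ≤ p := by exact_mod_cast Nat.lt_succ_iff.mp h
      have : (m : ℝ) ≤ r := by rw [hr, le_div_iff₀ hd']; exact h'
      push_cast
      linarith
  have har : (a : ℝ) ≤ r * (s - 1) := by
    rcases ht with h | h
    · have h' : (d : ℝ) ≤ t * p := by exact_mod_cast h
      have h1 : 1 ≤ (t : ℝ) * r := by
        rw [hr, mul_div_assoc', le_div_iff₀ hd']; linarith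
      have ha0 : (0 : ℝ) ≤ a := Nat.cast_nonneg a
      nlinarith
    · have : a = 0 := by
        by_contra hne
        have := Nat.mul_le_mul (Nat.one_le_iff_ne_zero.mpr hne) h
        omega
      have hs : (1 : ℝ) ≤ s := by rw [this] at hs1; simpa using hs1
      rw [this, Nat.cast_zero]
      exact mul_nonneg hr0.le (by linarith)
  have hw' : (w : ℝ) ≤ s + a + q * x := by exact_mod_cast hw
  have hx : (q : ℝ) * x ≤ (1 + r) * x := mul_le_mul_of_nonneg_right hqr (Nat.cast_nonneg x)
  push_cast
  nlinarith

/-- The number of components that are joined at a time: if `k` components are left, where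
`k ≤ D * t`, then joining `g` of them at a time, which takes `q` steps, needs `g ≤ 1 + 2 D / r`. -/
theorem group_bound {n k t q g p d : ℕ} {D : ℝ} (hD : 0 < D) (hp : 0 < p) (hd : 0 < d)
    (hkn : k ≤ n) (hk : (k : ℝ) ≤ D * t) (ht : t = 1 ∨ (t - 1) * p < d ∧ t ≤ n) (ht1 : 1 ≤ t)
    (hq : p + 1 ≤ q * d ∨ n ≤ q) (hq1 : 1 ≤ q) (hg : g = 1 ∨ (g - 1) * q < k - 1 ∧ g ≤ n)
    (hg1 : 1 ≤ g) : (g : ℝ) ≤ 1 + 2 * (D / ((p : ℝ) / d)) := by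
  have hd' : (0 : ℝ) < d := by exact_mod_cast hd
  have hp' : (0 : ℝ) < p := by exact_mod_cast hp
  set r : ℝ := (p : ℝ) / d with hr
  have hr0 : 0 < r := div_pos hp' hd'
  have hDr : 0 < D / r := div_pos hD hr0
  obtain ⟨m, rfl⟩ := Nat.exists_eq_add_of_le hg1
  rw [Nat.add_sub_cancel_left] at hg
  rcases Nat.eq_zero_or_pos m with rfl | hm
  · push_cast; linarith
  have hmq : m * q < k - 1 := by
    rcases hg with h | h
    · omega
    · exact h.1
  rcases hq with hq | hq
  swap
  · have := Nat.mul_le_mul hm hq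
    omega
  have hqr : r ≤ q := by
    rw [hr, div_le_iff₀ hd']
    exact_mod_cast (by omega : p ≤ q * d)
  have hq1' : (1 : ℝ) ≤ q := by exact_mod_cast hq1
  have htr : (t : ℝ) * r ≤ r + 1 := by
    rcases ht with h | ⟨h, _⟩
    · rw [h]; push_cast; linarith
    · obtain ⟨e, rfl⟩ := Nat.exists_eq_add_of_le ht1
      rw [Nat.add_sub_cancel_left] at h
      have h' : (e : ℝ) * p ≤ d := by exact_mod_cast h.le
      have : (e : ℝ) * r ≤ 1 := by rw [hr, mul_div_assoc', div_le_one hd']; exact h'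
      push_cast
      linarith
  have hmq' : (m : ℝ) * q ≤ k := by exact_mod_cast (by omega : m * q ≤ k)
  have hmr : (m : ℝ) * r ≤ 2 * D := by
    have h1 : (m : ℝ) * q * r ≤ D * t * r :=
      mul_le_mul_of_nonneg_right (hmq'.trans hk) hr0.le
    have h2 : D * (t * r) ≤ D * (2 * q) := mul_le_mul_of_nonneg_left (by linarith) hD.le
    have h3 : (m : ℝ) * r * q ≤ 2 * D * q := by linarith
    exact le_of_mul_le_mul_right h3 (by linarith)
  have : (m : ℝ) ≤ 2 * (D / r) := by
    rw [mul_div_assoc', le_div_iff₀ hr0]; exact hmr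
  push_cast
  linarith

theorem wp_approxSteiner {y n p d : ℕ} {D : ℝ} {G : SimpleGraph (Fin n)} {S : Finset (Fin n)}
    {σ : State} (hG : G.Connected) (hD : 0 < D) (hdense : IsDenseSteinerInstance G (S : Set _) D)
    (hp : 0 < p) (hd : 0 < d) (hny : n ≤ y)
    (hy : (2 : ℝ) ^ (2 + 2 * (D / ((p : ℝ) / d))) ≤ y) (hn : σ.var x_n = n)
    (hnum : σ.var x_num = p) (hden : σ.var x_den = d)
    (hadj : open Classical in ∀ u v : Fin n, σ.arr a_adj (u * n + v) = if G.Adj u v then 1 else 0)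
    (hterm : ∀ v : Fin n, σ.arr a_term v = if v ∈ S then 1 else 0) :
    approxSteiner.wp y (fun τ => ∃ W S₀ : Finset (Fin n), HasSet W τ ∧ Labelled G W τ ∧
      numComp G W ≤ 1 ∧ S ⊆ W ∧ W.Nonempty ∧
      ((S.Nonempty ∧ S₀ = S) ∨ (S = ∅ ∧ ∃ v, S₀ = {v})) ∧
      ∀ B v, Rooted G B v → S₀ ⊆ B →
        (W.card : ℝ) - 1 ≤ (1 + (p : ℝ) / d) * ((B.card : ℝ) - 1)) σ := by
  have hn0 : 0 < n := by
    obtain ⟨v⟩ := hG.nonempty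
    exact v.pos
  unfold approxSteiner
  refine wp_seq_of (wp_fillMultiples hn hny hn (by decide) fun τ _ h => h) ?_
  intro σ₁ hF₁ hrow
  refine wp_seq_of (wp_fillPowers ((hF₁.var x_n rfl).trans hn) hny fun τ _ h => h) ?_
  intro σ₂ hF₂ hpow
  have hC₂ : Ctx G σ₂ := by
    refine ⟨by rw [hF₂.var x_n rfl, hF₁.var x_n rfl, hn], fun v => ?_, hpow, fun u v => ?_⟩
    · rw [hF₂.arr a_row rfl, hrow v v.isLt.le]
    · rw [hF₂.arr a_adj rfl, hF₁.arr a_adj rfl, hadj]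
  refine wp_seq_of (wp_copyTerminals (S := S) hny hn0 hC₂.num fun v => by
    rw [hF₂.arr a_term rfl, hF₁.arr a_term rfl, hterm]) ?_
  rintro σ₃ hF₃ ⟨S₀, hS₀, hcase⟩
  have hC₃ : Ctx G σ₃ := hC₂.frame hF₃ rfl rfl rfl rfl
  have hnum₃ : σ₃.var x_num = p := by
    rw [hF₃.var x_num rfl, hF₂.var x_num rfl, hF₁.var x_num rfl, hnum]
  have hden₃ : σ₃.var x_den = d := by
    rw [hF₃.var x_den rfl, hF₂.var x_den rfl, hF₁.var x_den rfl, hden]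
  have hS₀ne : S₀.Nonempty := by
    rcases hcase with ⟨h, rfl⟩ | ⟨_, v, rfl⟩
    · exact h
    · exact Finset.singleton_nonempty v
  have hSS₀ : S ⊆ S₀ := by
    rcases hcase with ⟨_, rfl⟩ | ⟨h, _⟩
    · exact subset_rfl
    · rw [h]; exact Finset.empty_subset _
  refine wp_seq_of (wp_divide (a := d) (b := p) hC₃.num hny (by decide) (by decide)
    (fun ρ hF => (hF.var x_den rfl).trans hden₃) (fun ρ hF => (hF.var x_num rfl).trans hnum₃)) ?_
  rintro σ₄ hF₄ ⟨t, ht, ht1, hta, htb⟩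
  have hC₄ : Ctx G σ₄ := hC₃.frame hF₄ rfl rfl rfl rfl
  refine wp_seq_of (wp_divide (a := p + 1) (b := d) hC₄.num hny (by decide) (by decide)
    (fun ρ hF => by
      rw [Exp.val_add, Exp.val_var, hF.var x_num rfl, hF₄.var x_num rfl, hnum₃, Exp.val_const])
    (fun ρ hF => by rw [Exp.val_var, hF.var x_den rfl, hF₄.var x_den rfl, hden₃])) ?_
  rintro σ₅ hF₅ ⟨q, hq, hq1, hqa, hqb⟩
  have hC₅ : Ctx G σ₅ := hC₄.frame hF₅ rfl rfl rfl rfl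
  refine wp_seq_of (wp_grow hny hC₅ ((hS₀.frame hF₄ rfl).frame hF₅ rfl) hS₀ne
    ((hF₅.var x_t rfl).trans ht) ht1) ?_
  rintro σ₆ hF₆ ⟨U, H, L, hU, hI, hJ, hL, hk, hseen⟩
  have hC₆ : Ctx G σ₆ := hC₅.frame hF₆ rfl rfl rfl rfl
  have hq₆ : σ₆.var x_q = q := (hF₆.var x_q rfl).trans hq
  refine wp_seq_of (wp_divide (a := numComp G U - 1) (b := q) hC₆.num hny (by decide) (by decide)
    (fun ρ hF => by
      rw [Exp.val_sub, Exp.val_var, hF.var x_k rfl, hk, Exp.val_const])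
    (fun ρ hF => (hF.var x_q rfl).trans hq₆)) ?_
  rintro σ₇ hF₇ ⟨g, hg, hg1, hga, hgb⟩
  have hkn : numComp G U ≤ n :=
    (numComp_le_card U fun x hx => ⟨x, hx, .rfl⟩).trans ((Finset.card_le_univ U).trans (by simp))
  have hU0 : U.Nonempty := hS₀ne.mono hI.subset
  have hkpos : 1 ≤ numComp G U := one_le_numComp hU0
  have hgq : numComp G U - 1 ≤ g * q := by
    rcases hga with h | h
    · exact h
    · exact ((Nat.sub_le _ 1).trans (hkn.trans h)).trans (Nat.le_mul_of_pos_right g hq1)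
  have hgy : 2 ≤ numComp G U → 2 ^ (g + 1) ≤ y := by
    intro h2
    -- With two components there is a terminal, and not every vertex is a terminal.
    have hS : S.Nonempty ∧ S₀ = S := by
      refine hcase.resolve_right ?_
      rintro ⟨_, v, rfl⟩
      have := hI.card_le
      rw [Finset.card_singleton] at this
      have := Nat.mul_le_mul_right t (Finset.card_pos.mpr hU0)
      omega
    obtain ⟨hSne, rfl⟩ := hS
    have hout : ∃ w, w ∉ S₀ := by
      by_contra! hall
      obtain ⟨v, hv⟩ := hSne
      refine absurd (numComp_le_card (G := G) (U := U) {v} fun x _ => ⟨v, by simp, ?_⟩)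
        (by rw [Finset.card_singleton]; omega)
      exact (hG.preconnected x v).mono fun a b hab => ⟨hab, hI.subset (hall a), hI.subset (hall b)⟩
    have hkD := numComp_le_of_dense hD hdense hout hL hI.subset hI.anchored hseen
    have hgD := group_bound hD hp hd hkn hkD htb ht1 hqa hq1 hgb hg1
    have : (2 : ℝ) ^ (g + 1) ≤ y := by
      refine le_trans ?_ hy
      rw [← Real.rpow_natCast]
      refine Real.rpow_le_rpow_of_exponent_le (by norm_num) ?_
      push_cast
      linarith
    exact_mod_cast this
  refine Prog.wp_mono (wp_merge (U := U) hny hgy hG (hC₆.frame hF₇ rfl rfl rfl rfl)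
    (hU.frame hF₇ rfl) ⟨H, L, hJ.frame hF₇ rfl rfl, hL, (hF₇.var x_k rfl).trans hk⟩ hg hg1
    hI.subset hI.anchored hU0 hgq) ?_
  rintro τ ⟨W, h1, h2, h3, h4, h5, h6⟩
  refine ⟨W, S₀, h1, h2, h3, hSS₀.trans h4, h5, hcase, fun B v hB hSB => ?_⟩
  have hcard := Finset.card_sdiff_add_card_eq_card hSB
  obtain ⟨a, ha⟩ := Nat.exists_eq_add_of_le (Finset.card_le_card hI.subset)
  have hpot := hI.card_le
  rw [ha, Nat.add_mul] at hpot
  have hfin := ratio_bound (n := n) (s := S₀.card) (a := a) (t := t) (q := q)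
    (x := (B \ S₀).card) (w := W.card) hp hd ((Finset.card_le_univ S₀).trans (by simp)) (by omega)
    hta hqb hq1 (by rw [← ha]; exact h6 B v hB hSB)
  rwa [Nat.add_comm, hcard] at hfin

/-! ### Steiner trees and connected vertex sets -/

theorem treeSize_add_one {V : Type*} [Fintype V] {G : SimpleGraph V} {T : G.Subgraph}
    (h : T.coe.IsTree) : treeSize T + 1 = T.verts.ncard := by
  classical
  have h1 := h.card_edgeFinset
  rw [← Nat.card_eq_fintype_card, Nat.card_coe_set_eq] at h1
  rw [← h1, treeSize, ← T.image_coe_edgeSet_coe,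
    Set.ncard_image_of_injective _ (Sym2.map.injective Subtype.val_injective),
    ← SimpleGraph.coe_edgeFinset, Set.ncard_coe_finset]

theorem rooted_of_isTree {V : Type*} [Fintype V] {G : SimpleGraph V} {T : G.Subgraph}
    (h : T.coe.IsTree) {B : Finset V} (hB : ∀ v, v ∈ B ↔ v ∈ T.verts) {v : V} (hv : v ∈ B) :
    Rooted G B v := by
  refine ⟨hv, fun x hx => ?_⟩
  let f : T.coe →g inside G B :=
    ⟨Subtype.val, fun {a b} hab => ⟨T.adj_sub hab, (hB _).mpr a.2, (hB _).mpr b.2⟩⟩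
  exact (h.connected.preconnected ⟨v, (hB v).mp hv⟩ ⟨x, (hB x).mp hx⟩).map f

/-- The subgraph with vertex set `W` and the edges of `H`. -/
def forestSubgraph {V : Type*} {G H : SimpleGraph V} {W : Finset V} (hH : H ≤ inside G W) :
    G.Subgraph where
  verts := W
  Adj := H.Adj
  adj_sub h := (hH h).1
  edge_vert h := (hH h).2.1
  symm := H.symm

theorem forestSubgraph_isTree {n : ℕ} {G H : SimpleGraph (Fin n)} {W : Finset (Fin n)}
    {L : Fin n → Fin n} {σ : State} (hJ : Forest G W H L σ) (hL : IsLabel G W L)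
    (hk : numComp G W ≤ 1) (hW : W.Nonempty) : (forestSubgraph hJ.le).coe.IsTree := by
  have hreach : ∀ x (hx : x ∈ W) y, H.Reachable x y →
      ∃ hy : y ∈ W, (forestSubgraph hJ.le).coe.Reachable ⟨x, hx⟩ ⟨y, hy⟩ := by
    intro x hx y hxy
    rw [SimpleGraph.reachable_iff_reflTransGen] at hxy
    induction hxy with
    | refl => exact ⟨hx, .rfl⟩
    | @tail a b _ hab ih =>
      obtain ⟨ha, h⟩ := ih
      exact ⟨(hJ.le hab).2.2, h.trans (SimpleGraph.Adj.reachable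
        (show (forestSubgraph hJ.le).Adj a b from hab))⟩
  refine ⟨@SimpleGraph.Connected.mk _ _ ?_ ?_, ?_⟩
  · rintro ⟨x, hx⟩ ⟨y, hy⟩
    obtain ⟨_, h⟩ := hreach x hx y ((hJ.eq_iff x y).mp
      ((hL.eq_iff x y).mpr (reachable_of_numComp_le_one hk hx hy)))
    exact h
  · obtain ⟨w, hw⟩ := hW
    exact ⟨⟨w, hw⟩⟩
  · exact hJ.acyclic.comap (⟨Subtype.val, fun {a b} hab => hab⟩ :
      (forestSubgraph hJ.le).coe →g H) Subtype.val_injective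

/-- A step count polynomial in `n * N` with `N` at most `8 * 2 ^ (4 * x)`, in the form
`C * n ^ C * 2 ^ (C * x)`. -/
theorem time_bound {t n N C : ℕ} {x : ℝ} (hn : 1 ≤ n) (hx : 0 < x)
    (hN : (N : ℝ) ≤ 8 * (2 : ℝ) ^ (4 * x)) (ht : t ≤ C * (n * N) ^ C) :
    (t : ℝ) ≤ ((C * 8 ^ C + 4 * C : ℕ) : ℝ) * (n : ℝ) ^ (C * 8 ^ C + 4 * C) *
      (2 : ℝ) ^ (((C * 8 ^ C + 4 * C : ℕ) : ℝ) * x) := by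
  have hn1 : (1 : ℝ) ≤ n := by exact_mod_cast hn
  have ht' : (t : ℝ) ≤ C * ((n : ℝ) * N) ^ C := by exact_mod_cast ht
  have hpow : (n : ℝ) ^ C ≤ (n : ℝ) ^ (C * 8 ^ C + 4 * C) :=
    pow_le_pow_right₀ hn1 (by omega)
  have hcoef : (C * 8 ^ C : ℝ) ≤ ((C * 8 ^ C + 4 * C : ℕ) : ℝ) := by
    push_cast
    linarith [(Nat.cast_nonneg C : (0 : ℝ) ≤ C)]
  have hexp : ((2 : ℝ) ^ (4 * x)) ^ C ≤ (2 : ℝ) ^ (((C * 8 ^ C + 4 * C : ℕ) : ℝ) * x) := by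
    rw [← Real.rpow_mul_natCast (by norm_num)]
    refine Real.rpow_le_rpow_of_exponent_le (by norm_num) ?_
    have : (0 : ℝ) ≤ C * 8 ^ C * x := by positivity
    push_cast
    linarith
  calc (t : ℝ) ≤ C * ((n : ℝ) * N) ^ C := ht'
    _ ≤ C * ((n : ℝ) * (8 * (2 : ℝ) ^ (4 * x))) ^ C := by gcongr
    _ = (C * 8 ^ C : ℝ) * (n : ℝ) ^ C * ((2 : ℝ) ^ (4 * x)) ^ C := by
      rw [mul_pow, mul_pow]; ring
    _ ≤ _ := by gcongr

theorem rat_toNat_div_den {r : ℚ} (hr : 0 < r) : ((r.num.toNat : ℕ) : ℝ) / (r.den : ℝ) = r := by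
  have h1 : ((r.num.toNat : ℕ) : ℤ) = r.num := Int.toNat_of_nonneg (Rat.num_pos.mpr hr).le
  have h2 : ((r.num.toNat : ℕ) : ℝ) = (r.num : ℝ) := by
    exact_mod_cast congrArg (Int.cast (R := ℝ)) h1
  rw [h2]
  exact_mod_cast (Rat.cast_def (K := ℝ) r).symm

theorem wp_approxSteiner_steinerInput {y n : ℕ} {D : ℝ} {r : ℚ} {G : SimpleGraph (Fin n)}
    {S : Set (Fin n)} (hG : G.Connected) (hD : 0 < D) (hdense : IsDenseSteinerInstance G S D)
    (hr : 0 < r) (hny : n ≤ y) (hy : (2 : ℝ) ^ (2 + 2 * (D / r)) ≤ y) :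
    approxSteiner.wp y (fun τ => ∃ T : G.Subgraph, HoldsSubgraph τ T ∧ IsSteinerTree S T ∧
      ∀ T' : G.Subgraph, IsSteinerTree S T' → (treeSize T : ℝ) ≤ (1 + r) * treeSize T')
      (steinerInput G S r) := by
  classical
  have hpos : 0 < r.num.toNat := by
    have := Rat.num_pos.mpr hr
    omega
  have hr0 : (0 : ℝ) < r := by exact_mod_cast hr
  have hadj : ∀ u v : Fin n, (steinerInput G S r).arr a_adj (u * n + v) =
      if G.Adj u v then 1 else 0 := by
    intro u v
    simp only [steinerInput, if_true]
    refine if_congr ⟨?_, fun h => ⟨u, v, rfl, h⟩⟩ rfl rfl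
    rintro ⟨i, j, hij, h⟩
    rw [cell_inj v.isLt j.isLt] at hij
    rwa [Fin.ext hij.1, Fin.ext hij.2]
  have hterm : ∀ v : Fin n, (steinerInput G S r).arr a_term v =
      if v ∈ S.toFinset then 1 else 0 := by
    intro v
    simp only [steinerInput, one_ne_zero, if_false, if_true, Set.mem_toFinset]
    refine if_congr ⟨?_, fun h => ⟨v, rfl, h⟩⟩ rfl rfl
    rintro ⟨i, hi, h⟩
    rwa [Fin.ext hi]
  refine Prog.wp_mono (wp_approxSteiner (S := S.toFinset) hG hD
    (by simpa using hdense) hpos r.den_pos hny (by rwa [rat_toNat_div_den hr]) rfl rfl rfl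
    (fun u v => (hadj u v).trans (if_congr Iff.rfl rfl rfl)) hterm) ?_
  rintro τ ⟨W, S₀, h1, ⟨H, L, hJ, hL, _⟩, h3, hSW, h5, hcase, h6⟩
  rw [rat_toNat_div_den hr] at h6
  have htree := forestSubgraph_isTree hJ hL h3 h5
  have hsize : (treeSize (forestSubgraph hJ.le) : ℝ) = (W.card : ℝ) - 1 := by
    have := treeSize_add_one htree
    rw [show (forestSubgraph hJ.le).verts = (W : Set (Fin n)) from rfl, Set.ncard_coe_finset] at this
    rw [← this]; push_cast; ring
  refine ⟨forestSubgraph hJ.le, ⟨fun i j => (hJ.tree i j).trans (if_congr Iff.rfl rfl rfl),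
    fun i => (h1 i).trans (if_congr Iff.rfl rfl rfl)⟩,
    ⟨htree, fun v hv => hSW (Set.mem_toFinset.mpr hv)⟩, ?_⟩
  rintro T' ⟨hT', hST'⟩
  have hsize' := treeSize_add_one hT'
  rw [hsize]
  rcases hcase with ⟨⟨s, hs⟩, rfl⟩ | ⟨_, v, rfl⟩
  · have hB : ∀ v, v ∈ T'.verts.toFinset ↔ v ∈ T'.verts := fun v => Set.mem_toFinset
    have hle := h6 T'.verts.toFinset s
      (rooted_of_isTree hT' hB ((hB s).mpr (hST' (Set.mem_toFinset.mp hs))))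
      (Set.toFinset_subset_toFinset.mpr hST')
    rwa [← Set.ncard_eq_toFinset_card', ← hsize', Nat.cast_add, Nat.cast_one,
      add_sub_cancel_right] at hle
  · -- Without terminals the algorithm outputs a single vertex.
    have hle := h6 {v} v (.singleton v) subset_rfl
    rw [Finset.card_singleton, Nat.cast_one, sub_self, mul_zero] at hle
    exact hle.trans (by positivity)

end DenseSteiner

open RAM DenseSteiner in
theorem theorem5p1 :
    ∃ (P : RAM.Prog) (C : ℕ),
      ∀ (ψ : ℕ → ℝ), (∀ n, 0 < ψ n) →
      ∀ (δ : ℝ), 0 < δ →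
      ∀ (r : ℚ), δ / 2 ≤ (r : ℝ) → (r : ℝ) ≤ δ →
      ∀ (n : ℕ) (G : SimpleGraph (Fin n)) (S : Set (Fin n)),
        G.Connected → IsDenseSteinerInstance G S (ψ n) →
        ∃ (σ : RAM.State) (t : ℕ) (T : G.Subgraph),
          RAM.Exec P (steinerInput G S r) σ t ∧
          (t : ℝ) ≤ C * (n : ℝ) ^ C * (2 : ℝ) ^ ((C : ℝ) * (ψ n / δ)) ∧
          HoldsSubgraph σ T ∧
          IsSteinerTree S T ∧
          ∀ T' : G.Subgraph, IsSteinerTree S T' →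
            (treeSize T : ℝ) ≤ (1 + δ) * (treeSize T' : ℝ) := by
  classical
  -- Forgetting all but the specification keeps the program text out of unification.
  obtain ⟨P, hP⟩ : ∃ P : RAM.Prog, ∀ {y n : ℕ} {D : ℝ} {r : ℚ} {G : SimpleGraph (Fin n)}
      {S : Set (Fin n)}, G.Connected → 0 < D → IsDenseSteinerInstance G S D → 0 < r → n ≤ y →
      (2 : ℝ) ^ (2 + 2 * (D / r)) ≤ y → P.wp y (fun τ => ∃ T : G.Subgraph, HoldsSubgraph τ T ∧
        IsSteinerTree S T ∧ ∀ T' : G.Subgraph, IsSteinerTree S T' →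
          (treeSize T : ℝ) ≤ (1 + r) * treeSize T') (steinerInput G S r) :=
    ⟨approxSteiner, wp_approxSteiner_steinerInput⟩
  obtain ⟨C, hC⟩ := P.exists_time_le
  refine ⟨P, C * 8 ^ C + 4 * C, ?_⟩
  intro ψ hψ δ hδ r hr1 hr2 n G S hG hdense
  have hr0 : (0 : ℝ) < r := by linarith
  have hrq : 0 < r := by exact_mod_cast hr0
  have hn0 : 1 ≤ n := by
    obtain ⟨v⟩ := hG.nonempty
    exact v.pos
  -- The bound on the number of rounds of every loop.
  set e : ℝ := (2 : ℝ) ^ (4 * (ψ n / δ)) with he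
  have hψδ : 0 < ψ n / δ := div_pos (hψ n) hδ
  have he1 : 1 ≤ e := Real.one_le_rpow (by norm_num) (by positivity)
  set N : ℕ := ⌈4 * e⌉₊ with hN
  have hN1 : 1 ≤ N := Nat.one_le_ceil_iff.mpr (by linarith)
  have hN8 : (N : ℝ) ≤ 8 * e := by
    have := Nat.ceil_lt_add_one (show 0 ≤ 4 * e by linarith)
    linarith
  have hny : n ≤ n * N := Nat.le_mul_of_pos_right n hN1
  have hy : (2 : ℝ) ^ (2 + 2 * (ψ n / r)) ≤ ((n * N : ℕ) : ℝ) := by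
    have h1 : ψ n / r ≤ 2 * (ψ n / δ) := by
      rw [mul_div_assoc', div_le_div_iff₀ hr0 hδ]
      have := (hψ n).le
      nlinarith
    calc (2 : ℝ) ^ (2 + 2 * (ψ n / r)) ≤ (2 : ℝ) ^ (2 + 4 * (ψ n / δ)) :=
          Real.rpow_le_rpow_of_exponent_le (by norm_num) (by linarith)
      _ = 4 * e := by rw [Real.rpow_add (by norm_num), he]; norm_num
      _ ≤ N := Nat.le_ceil _
      _ ≤ _ := by exact_mod_cast Nat.le_mul_of_pos_left N hn0
  obtain ⟨τ, t, hexec, htime, T, hT, hST, hopt⟩ :=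
    Prog.exec_of_wp (hP hG (hψ n) hdense hrq hny hy)
  refine ⟨τ, t, T, hexec, time_bound hn0 hψδ hN8 (htime.trans (hC (n * N) (Nat.mul_pos hn0 hN1))),
    hT, hST, fun T' hT' => (hopt T' hT').trans ?_⟩
  gcongr
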